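/- Let $f\colon\mathbb{R}^d\to\mathbb{R}$ be locally Lipschitz, where $\mathbb{R}^d$ carries an inner product $\langle\cdot,\cdot\rangle$ and the induced norm. The Clarke subdifferential $\partial f(x)$ is the convex hull of all limits $\lim_i\nabla f(u_i)$ along sequences $u_i\to x$ of points at which $f$ is differentiable; $x$ is called critical for $f$ if $0\in\partial f(x)$. A set $M\subset\mathbb{R}^n$ is a $C^p$ manifold if there is an integer $0\le r\le n$ such that around every $x\in M$ there are a neighborhood $U$ and a $C^p$ map $F\colon U\to\mathbb{R}^{n-r}$ with $\nabla F(x)$ of full rank and $M\cap U=\{y\in U:F(y)=0\}$; then $T_M(x)=\mathrm{Null}(\nabla F(x))$ and $N_M(x)=T_M(x)^\perp$. A Whitney $C^p$-stratification of a set $Q$ is a partition of $Q$ into finitely many nonempty $C^p$ manifolds (strata) such that for any strata $L,M$: (frontier condition) $L\cap\mathrm{cl}\,M\ne\emptyset$ implies $L\subset\mathrm{cl}\,M$; (Whitney condition (a)) if $z_k\in M$ converge to $\bar z\in L$ and $v_k\in N_M(z_k)$ converge to $v$, then $v\in N_L(\bar z)$. Suppose that the graph of $f$, as a subset of $\mathbb{R}^d\times\mathbb{R}$,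 admits a Whitney $C^d$-stratification. Let $\{\alpha_k\}_{k\ge1}$ be real numbers with $\alpha_k\ge0$, $\sum_k\alpha_k=\infty$ and $\sum_k\alpha_k^2<\infty$. (Stochastic approximation) Let $x_{k+1}=x_k+\alpha_k(y_k+\xi_k)$ for $k\ge1$, where $x_k,y_k,\xi_k\in\mathbb{R}^d$, and suppose that (i) $\sup_k\|x_k\|<\infty$ and $\sup_k\|y_k\|<\infty$; (ii) the partial sums $\sum_{k=1}^n\alpha_k\xi_k$ converge as $n\to\infty$; (iii) for every strictly increasing sequence of indices $\{k_j\}_{j\ge1}$ such that $x_{k_j}$ converges to some $\bar x$, $$\lim_{n\to\infty}\mathrm{dist}\Big(\frac1n\sum_{j=1}^n y_{k_j},\,-\partial f(\bar x)\Big)=0.$$ Then every limit point of $\{x_k\}_{k\ge1}$ is critical for $f$, and the function values $\{f(x_k)\}_{k\ge1}$ converge. (Stochastic subgradient method) Let $x_k,y_k,\xi_k$, $k\ge1$, be $\mathbb{R}^d$-valued random variables on a probability space such that, almost surely, $x_{k+1}=x_k-\alpha_k(y_k+\xi_k)$ and $y_k\in\partial f(x_k)$ for all $k\ge1$. Suppose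 that (i) almost surely $\sup_k\|x_k\|<\infty$; (ii) $\{\xi_k\}$ is a martingale difference sequence: each $\xi_k$ is integrable, and there are increasing $\sigma$-fields $\mathcal{F}_k\supseteq\sigma(x_j,y_j,\xi_j:j<k)$ (for instance $\mathcal{F}_k=\sigma(x_j,y_j,\xi_j:j<k)$) and a function $p\colon\mathbb{R}^d\to[0,\infty)$, bounded on bounded sets, such that almost surely, for all $k$, $$\mathbb{E}[\xi_k\mid\mathcal{F}_k]=0\qquad\text{and}\qquad\mathbb{E}[\|\xi_k\|^2\mid\mathcal{F}_k]\le p(x_k).$$ Then almost surely every limit point of $\{x_k\}_{k\ge1}$ is critical for $f$ and the function values $\{f(x_k)\}_{k\ge1}$ converge. -/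

import Mathlib

open Set Filter Topology MeasureTheory
open scoped Pointwise ENNReal

/-! ### The Clarke subdifferential

`E` is a Euclidean space: a finite-dimensional real inner product space (`ℝ^d` with any inner
product, where `d = Module.finrank ℝ E`). -/

section Clarke

variable {E : Type*} [NormedAddCommGroup E] [InnerProductSpace ℝ E] [CompleteSpace E]

/-- The Clarke subdifferential: the convex hull of all limits of gradients `∇ f (u i)` along
sequences `u i → x` of points at which `f` is differentiable. -/
def clarkeSubdifferential (f : E → ℝ) (x : E) : Set E :=
  convexHull ℝ {v | ∃ u : ℕ → E, (∀ i, DifferentiableAt ℝ f (u i)) ∧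
    Tendsto u atTop (𝓝 x) ∧ Tendsto (fun i => gradient f (u i)) atTop (𝓝 v)}

/-- `x` is Clarke critical for `f` if `0 ∈ ∂f(x)`. -/
def IsClarkeCritical (f : E → ℝ) (x : E) : Prop :=
  (0 : E) ∈ clarkeSubdifferential f x

end Clarke

/-! ### Smooth manifolds in a Euclidean space and Whitney stratifications -/

section Whitney

variable {H : Type*} [NormedAddCommGroup H] [InnerProductSpace ℝ H]

/-- `F` is a `C^p` local defining map of `M` on the open neighbourhood `U` of `x`: the derivative
at `x` has full rank, and `M` is the zero set of `F` inside `U`. -/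
structure IsLocalDefiningMap (p : ℕ) (M : Set H) (x : H) {m : ℕ} (U : Set H)
    (F : H → EuclideanSpace ℝ (Fin m)) : Prop where
  isOpen : IsOpen U
  mem : x ∈ U
  contDiffOn : ContDiffOn ℝ p F U
  full_rank : Function.Surjective (fderiv ℝ F x)
  inter_eq : M ∩ U = {y ∈ U | F y = 0}

/-- `M` is a `C^p` manifold in `H`, of some dimension `r` (hence of codimension `m` with
`r + m = dim H`): around each of its points it has a local defining map into `ℝ^m`. -/
def IsSmoothManifold (p : ℕ) (M : Set H) : Prop :=
  ∃ r m : ℕ, r + m = Module.finrank ℝ H ∧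
    ∀ x ∈ M, ∃ (U : Set H) (F : H → EuclideanSpace ℝ (Fin m)), IsLocalDefiningMap p M x U F

/-- The tangent space `T_M(x)`: the null space of the derivative at `x` of a local defining map
(for `p ≥ 1` this does not depend on the defining map). -/
def tangentSpaceAt (p : ℕ) (M : Set H) (x : H) : Set H :=
  {w | ∃ (m : ℕ) (U : Set H) (F : H → EuclideanSpace ℝ (Fin m)),
    IsLocalDefiningMap p M x U F ∧ fderiv ℝ F x w = 0}

/-- The normal space `N_M(x)`: the orthogonal complement of the tangent space. -/
def normalSpaceAt (p : ℕ) (M : Set H) (x : H) : Set H :=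
  {v | ∀ w ∈ tangentSpaceAt p M x, inner ℝ v w = 0}

/-- `A` is a Whitney `C^p`-stratification of `Q`: a partition of `Q` into finitely many nonempty
`C^p` manifolds satisfying the frontier condition and Whitney's condition (a). -/
structure IsWhitneyStratification (p : ℕ) (Q : Set H) (A : Set (Set H)) : Prop where
  finite : A.Finite
  nonempty : ∀ M ∈ A, M.Nonempty
  disjoint : A.PairwiseDisjoint id
  sUnion_eq : ⋃₀ A = Q
  manifold : ∀ M ∈ A, IsSmoothManifold p M
  frontier : ∀ L ∈ A, ∀ M ∈ A, (L ∩ closure M).Nonempty → L ⊆ closure M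
  whitney_a : ∀ L ∈ A, ∀ M ∈ A, ∀ (z : ℕ → H) (v : ℕ → H) (z' v' : H),
    (∀ k, z k ∈ M) → z' ∈ L → Tendsto z atTop (𝓝 z') →
    (∀ k, v k ∈ normalSpaceAt p M (z k)) → Tendsto v atTop (𝓝 v') →
    v' ∈ normalSpaceAt p L z'

/-- The graph of `f`, in the product `E × ℝ` with its Euclidean (`ℓ²`) structure. -/
def euclideanGraph {E : Type*} (f : E → ℝ) : Set (WithLp 2 (E × ℝ)) :=
  Set.range fun x => WithLp.toLp 2 (x, f x)

/-- `f` is Whitney `C^p`-stratifiable if its graph admits a Whitney `C^p`-stratification. -/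
def IsWhitneyStratifiable {E : Type*} [NormedAddCommGroup E] [InnerProductSpace ℝ E]
    (p : ℕ) (f : E → ℝ) : Prop :=
  ∃ A : Set (Set (WithLp 2 (E × ℝ))), IsWhitneyStratification p (euclideanGraph f) A

end Whitney

/-! ### The iterations and their standing assumptions -/

section Assumptions

variable {E : Type*} [NormedAddCommGroup E] [InnerProductSpace ℝ E]

/-- Nonnegative step sizes, square summable but not summable. -/
structure StepSizes (α : ℕ → ℝ) : Prop where
  nonneg : ∀ k, 0 ≤ α k
  not_summable : ¬ Summable α
  sq_summable : Summable fun k => α k ^ 2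

/-- The iteration `x_{k+1} = x_k + α_k (y_k + ξ_k)` for a set-valued map `G` on `X`, with the
standing assumptions of stochastic approximation. -/
structure StochasticApproximation (X : Set E) (G : E → Set E) (α : ℕ → ℝ) (x y ξ : ℕ → E) :
    Prop where
  step : ∀ k, x (k + 1) = x k + α k • (y k + ξ k)
  limit_mem : ∀ z, MapClusterPt z atTop x → z ∈ X
  bounded_iterates : ∃ C : ℝ, ∀ k, ‖x k‖ ≤ C
  bounded_directions : ∃ C : ℝ, ∀ k, ‖y k‖ ≤ C
  steps : StepSizes α
  noise : ∃ v : E, Tendsto (fun n => ∑ k ∈ Finset.range n, α k • ξ k) atTop (𝓝 v)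
  average : ∀ (κ : ℕ → ℕ) (z : E), StrictMono κ → Tendsto (fun j => x (κ j)) atTop (𝓝 z) →
    Tendsto (fun n : ℕ => Metric.infDist ((n : ℝ)⁻¹ • ∑ j ∈ Finset.range n, y (κ j)) (G z))
      atTop (𝓝 0)

/-- The `σ`-field generated by `x_j, y_j, ξ_j` for `j < k`. -/
@[reducible] def pastSigma {Ω : Type*} [MeasurableSpace E] (x y ξ : ℕ → Ω → E) (k : ℕ) : MeasurableSpace Ω :=
  ⨆ j : {j : ℕ // j < k}, (MeasurableSpace.comap (x j) inferInstance ⊔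
    MeasurableSpace.comap (y j) inferInstance ⊔ MeasurableSpace.comap (ξ j) inferInstance)

/-- The stochastic subgradient method `x_{k+1} = x_k - α_k (y_k + ξ_k)`, `y_k ∈ ∂f(x_k)`, with its
standing assumptions. The noise is a martingale difference sequence with respect to increasing
`σ`-fields `ℱ k` that contain the past (for instance `pastSigma x y ξ k` itself, or that `σ`-field
enlarged by `x_k` and `y_k`). Its conditional second moment is the `ℝ≥0∞`-valued conditional
expectation, so that a bound on it does not presuppose square integrability. -/
structure StochasticSubgradientMethod [CompleteSpace E] [MeasurableSpace E] {Ω : Type*}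
    [MeasurableSpace Ω] (μ : Measure Ω) (f : E → ℝ) (α : ℕ → ℝ) (x y ξ : ℕ → Ω → E) : Prop where
  step : ∀ᵐ ω ∂μ, ∀ k, x (k + 1) ω = x k ω - α k • (y k ω + ξ k ω)
  subgradient : ∀ᵐ ω ∂μ, ∀ k, y k ω ∈ clarkeSubdifferential f (x k ω)
  steps : StepSizes α
  bounded_iterates : ∀ᵐ ω ∂μ, ∃ C : ℝ, ∀ k, ‖x k ω‖ ≤ C
  noise : ∃ ℱ : Filtration ℕ ‹MeasurableSpace Ω›, (∀ k, pastSigma x y ξ k ≤ ℱ k) ∧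
    ∃ p : E → ℝ, (∀ z, 0 ≤ p z) ∧ (∀ B : Set E, Bornology.IsBounded B → BddAbove (p '' B)) ∧
      ∀ k, Integrable (ξ k) μ ∧ μ[ξ k | ℱ k] =ᵐ[μ] 0 ∧
        condLExp (ℱ k) μ (fun ω => ‖ξ k ω‖ₑ ^ 2) ≤ᵐ[μ] fun ω => ENNReal.ofReal (p (x k ω))

end Assumptions

/-! In the time scale given by the partial sums of `α`, the iterates shadow solutions of z' ∈
-∂f(z). What makes f a Lyapunov function for this inclusion is the projection formula
`IsWhitneyStratification.toLp_mem_normalSpaceAt`: if v ∈ ∂f(x), then (v, -1) is normal to the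
stratum through (x, f x). For limits of gradients this is Whitney's condition (a) along a
subsequence staying in one of the finitely many strata; the passage to the hull is convexity of the
normal space.

Two consequences carry the proof. First, a chain rule (`IsWhitneyStratification.ae_deriv_comp_eq`):
at almost every time the lifted curve (z, f ∘ z) accumulates in its own stratum, so its velocity is
tangent there and orthogonal to (v, -1). Along a solution this gives (f ∘ z)' = -‖z'‖², and f drops
at a definite rate near a noncritical starting point (`IsWhitneyStratification.exists_le_sub_mul`).
Second, a Sard theorem (`IsWhitneyStratification.volume_image_critical_eq_zero`): at a critical x
the vector (0, -1) is normal, so the height restricted to the stratum is critical there. A stratum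
with such a point has dimension at most d, so the sharp Morse–Sard theorem
`volume_image_eq_zero_of_fderiv_eq_zero` needs only class C^d.

The tail of the convergent noise series is absorbed into the iterates. Ultrafilter limits of the
shifted trajectories are then Lipschitz solutions. If the values f(x_k) oscillated, they would cross
upwards infinitely often from a noncritical level a to some b > a; the limit of these crossings
starts at height a, descends at once, and yet reaches b. So the values converge, f is constant on
every limit arc, and such an arc cannot start at a noncritical point. In the stochastic method the
noise series converges almost surely by martingale convergence, after truncation at bounded
conditional variance. -/

/-! ### The Morse–Sard theorem for real-valued functions, with sharp smoothness -/

section Sard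

/-- A real function with `h x - h y = o(‖x - y‖ ^ m)` at every point `y` of a subset of `ℝ^m` maps
that set to a null set. -/
theorem volume_image_eq_zero_of_isLittleO {m : ℕ} {B : Set (Fin m → ℝ)} {h : (Fin m → ℝ) → ℝ}
    (hB : ∀ y ∈ B, (fun x => h x - h y) =o[𝓝 y] fun x => ‖x - y‖ ^ m) :
    volume (h '' B) = 0 := by
  have key : ∀ B' ⊆ B, volume B' ≠ ∞ → volume (h '' B') = 0 := by
    intro B' hB' hfin
    have bound : ∀ ε : ℝ, 0 < ε →
        volume (h '' B') ≤ ENNReal.ofReal (2 * ε) * (volume B' + 1) := by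
      intro ε hε
      -- Besicovitch covering by balls on which the flatness estimate holds with constant ε, of
      -- total volume at most `volume B' + 1`. No measurability of `B'` is needed.
      obtain ⟨t, r, htc, htB, hr, hcov, hsum⟩ :=
        Besicovitch.exists_closedBall_covering_tsum_measure_le (volume : Measure (Fin m → ℝ))
          (ε := 1) one_ne_zero
          (fun y => {r | 0 < r ∧ ∀ x ∈ Metric.closedBall y r, |h x - h y| ≤ ε * ‖x - y‖ ^ m}) B' (by
            intro y hy δ hδ
            have h1 := (hB y (hB' hy)).bound hε
            obtain ⟨ρ, hρ, hρ'⟩ := Metric.eventually_nhds_iff_ball.1 h1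
            refine ⟨min (ρ / 2) (δ / 2), ⟨by positivity, fun x hx => ?_⟩, by positivity, ?_⟩
            · have := hρ' x (by
                rw [Metric.mem_ball]
                have := Metric.mem_closedBall.1 hx
                have := min_le_left (ρ / 2) (δ / 2)
                linarith)
              simpa using this
            · have := min_le_right (ρ / 2) (δ / 2)
              linarith)
      have hsub : h '' B' ⊆ ⋃ y ∈ t, Metric.closedBall (h y) (ε * r y ^ m) := by
        rintro _ ⟨x, hx, rfl⟩
        obtain ⟨y, hy, hxy⟩ := mem_iUnion₂.1 (hcov hx)
        refine mem_iUnion₂.2 ⟨y, hy, ?_⟩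
        rw [Metric.mem_closedBall, Real.dist_eq]
        refine ((hr y hy).2 x hxy).trans ?_
        have : ‖x - y‖ ≤ r y := by rwa [← dist_eq_norm]
        gcongr
      calc volume (h '' B') ≤ volume (⋃ y ∈ t, Metric.closedBall (h y) (ε * r y ^ m)) :=
            measure_mono hsub
        _ ≤ ∑' y : t, volume (Metric.closedBall (h y) (ε * r y ^ m)) :=
            measure_biUnion_le _ htc _
        _ ≤ ∑' y : t, ENNReal.ofReal (2 * ε) * volume (Metric.closedBall (y : Fin m → ℝ) (r y)) := by
            refine ENNReal.tsum_le_tsum fun y => ?_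
            have hry : 0 < r y := (hr y y.2).1
            rw [Real.volume_closedBall, Real.volume_pi_closedBall _ hry.le,
              ← ENNReal.ofReal_mul (by positivity)]
            refine ENNReal.ofReal_le_ofReal ?_
            rw [Fintype.card_fin, mul_pow]
            -- A sup-norm ball of radius r is a cube of volume (2r)^m, which dominates r^m.
            have : (1 : ℝ) ≤ 2 ^ m := one_le_pow₀ (by norm_num)
            have h2 : 0 ≤ 2 * ε * r y ^ m := by positivity
            nlinarith
        _ = ENNReal.ofReal (2 * ε) * ∑' y : t, volume (Metric.closedBall (y : Fin m → ℝ) (r y)) :=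
            ENNReal.tsum_mul_left
        _ ≤ _ := by gcongr
    have hlim : Tendsto (fun ε : ℝ => ENNReal.ofReal (2 * ε) * (volume B' + 1)) (𝓝[>] 0) (𝓝 0) := by
      have h1 : Tendsto (fun ε : ℝ => ENNReal.ofReal (2 * ε)) (𝓝[>] 0) (𝓝 0) := by
        have : Continuous fun ε : ℝ => ENNReal.ofReal (2 * ε) :=
          ENNReal.continuous_ofReal.comp (continuous_const_mul 2)
        have := this.tendsto 0
        simp only [mul_zero, ENNReal.ofReal_zero] at this
        exact this.mono_left nhdsWithin_le_nhds
      have := ENNReal.Tendsto.mul_const (b := volume B' + 1) h1 (Or.inr (by finiteness))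
      simpa using this
    exact le_antisymm (ge_of_tendsto hlim (eventually_mem_nhdsWithin.mono fun ε hε => bound ε hε))
      zero_le
  have hBU : h '' B = ⋃ n : ℕ, h '' (B ∩ Metric.closedBall 0 n) := by
    rw [← image_iUnion, ← inter_iUnion, Metric.iUnion_closedBall_nat, inter_univ]
  rw [hBU, measure_iUnion_null_iff]
  intro n
  refine key _ inter_subset_left (ne_top_of_le_ne_top ?_ (measure_mono inter_subset_right))
  exact measure_closedBall_lt_top.ne

variable {U V W F : Type*} [NormedAddCommGroup U] [NormedSpace ℝ U] [NormedAddCommGroup V]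
  [NormedSpace ℝ V] [NormedAddCommGroup W] [NormedSpace ℝ W] [NormedAddCommGroup F]
  [NormedSpace ℝ F]

/-- If the derivative of `g` vanishes to order `k` along `ψ`, then `g ∘ ψ` is constant to order
`k + 1`. -/
theorem isLittleO_comp_sub_of_fderiv {g : V → F} {ψ : U → V} {y : U} {k : ℕ}
    (hg : ContDiffAt ℝ 1 g (ψ y)) (hψ : ContDiffAt ℝ 1 ψ y)
    (h : (fun x => fderiv ℝ g (ψ x)) =o[𝓝 y] fun x => ‖x - y‖ ^ k) :
    (fun x => g (ψ x) - g (ψ y)) =o[𝓝 y] fun x => ‖x - y‖ ^ (k + 1) := by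
  set K : ℝ := ‖fderiv ℝ ψ y‖ + 1 with hK
  have hKpos : 0 < K := by positivity
  have e1 : ∀ᶠ x in 𝓝 y, DifferentiableAt ℝ g (ψ x) :=
    hψ.continuousAt.eventually ((hg.eventually (by simp)).mono fun z hz => hz.differentiableAt (by simp))
  have e2 : ∀ᶠ x in 𝓝 y, DifferentiableAt ℝ ψ x :=
    (hψ.eventually (by simp)).mono fun z hz => hz.differentiableAt (by simp)
  have e3 : ∀ᶠ x in 𝓝 y, ‖fderiv ℝ ψ x‖ < K := by
    have : ContinuousAt (fderiv ℝ ψ) y := (hψ.fderiv_right (m := 0) (by simp)).continuousAt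
    exact this.norm.eventually_lt continuousAt_const (by rw [hK]; linarith)
  refine Asymptotics.IsLittleO.of_bound fun c hc => ?_
  have e4 := h.bound (show 0 < c / K by positivity)
  obtain ⟨ρ, hρ, H⟩ := Metric.eventually_nhds_iff_ball.1 (e1.and (e2.and (e3.and e4)))
  filter_upwards [Metric.ball_mem_nhds y hρ] with x hx
  have hsub : Metric.closedBall y ‖x - y‖ ⊆ Metric.ball y ρ := by
    intro z hz
    rw [Metric.mem_ball, dist_eq_norm] at hx
    exact lt_of_le_of_lt (Metric.mem_closedBall.1 hz) hx
  have hmv := (convex_closedBall y ‖x - y‖).norm_image_sub_le_of_norm_hasFDerivWithin_le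
    (f := fun z => g (ψ z)) (f' := fun z => (fderiv ℝ g (ψ z)).comp (fderiv ℝ ψ z))
    (C := c * ‖x - y‖ ^ k) (x := y) (y := x) (fun z hz => by
      obtain ⟨h1, h2, -⟩ := H z (hsub hz)
      exact (h1.hasFDerivAt.comp z h2.hasFDerivAt).hasFDerivWithinAt) (fun z hz => by
      obtain ⟨-, -, h3, h4⟩ := H z (hsub hz)
      have hzy : ‖z - y‖ ≤ ‖x - y‖ := by rw [← dist_eq_norm]; exact Metric.mem_closedBall.1 hz
      calc ‖(fderiv ℝ g (ψ z)).comp (fderiv ℝ ψ z)‖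
          ≤ ‖fderiv ℝ g (ψ z)‖ * ‖fderiv ℝ ψ z‖ := ContinuousLinearMap.opNorm_comp_le _ _
        _ ≤ (c / K * ‖x - y‖ ^ k) * K := by
          refine mul_le_mul (h4.trans ?_) h3.le (norm_nonneg _) (by positivity)
          rw [norm_pow, norm_norm]
          gcongr
        _ = c * ‖x - y‖ ^ k := by field_simp)
    (Metric.mem_closedBall_self (norm_nonneg _)) (by rw [Metric.mem_closedBall, dist_eq_norm])
  rw [norm_pow, norm_norm, pow_succ, ← mul_assoc]
  exact hmv

/-- Near a regular point, the zero set of a `C^k` map is parametrized by a `C^k` map defined on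
`ℝ^m`, where `m` is the dimension of the kernel of the derivative. -/
theorem exists_parametrization_of_surjective_fderiv [FiniteDimensional ℝ V]
    [FiniteDimensional ℝ W] {k : ℕ} (hk : k ≠ 0) {G : V → W} {p : V} (hG : ContDiffAt ℝ k G p)
    (hsurj : Function.Surjective (fderiv ℝ G p)) {m : ℕ}
    (hm : m + Module.finrank ℝ W = Module.finrank ℝ V) :
    ∃ φ : (Fin m → ℝ) → V, ∀ᶠ x in 𝓝 p, G x = 0 →
      ∃ t, φ t = x ∧ ContDiffAt ℝ k φ t ∧ ∀ᶠ s in 𝓝 t, G (φ s) = 0 := by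
  have := FiniteDimensional.complete ℝ V
  have := FiniteDimensional.complete ℝ W
  have hk' : (k : WithTop ℕ∞) ≠ 0 := by exact_mod_cast hk
  have hstrict : HasStrictFDerivAt G (fderiv ℝ G p) p := hG.hasStrictFDerivAt hk'
  have hrange : (fderiv ℝ G p).range = ⊤ := LinearMap.range_eq_top.2 hsurj
  have hker : (fderiv ℝ G p).ker.ClosedComplemented :=
    Submodule.ClosedComplemented.of_finiteDimensional _
  have hfin : Module.finrank ℝ (Fin m → ℝ) = Module.finrank ℝ (fderiv ℝ G p).ker := by
    have h1 := (fderiv ℝ G p).toLinearMap.finrank_range_add_finrank_ker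
    have h2 : Module.finrank ℝ (fderiv ℝ G p).range = Module.finrank ℝ W := by
      rw [hrange, finrank_top]
    rw [Module.finrank_fin_fun]
    change Module.finrank ℝ (fderiv ℝ G p).range + Module.finrank ℝ (fderiv ℝ G p).ker = _ at h1
    omega
  let L : (Fin m → ℝ) ≃L[ℝ] (fderiv ℝ G p).ker := ContinuousLinearEquiv.ofFinrankEq hfin
  let D := HasStrictFDerivAt.implicitFunctionDataOfComplemented G (fderiv ℝ G p) hstrict hrange hker
  let ψ : W × (fderiv ℝ G p).ker → V := D.implicitFunction.uncurry
  have hright : ContDiff ℝ k D.rightFun := by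
    change ContDiff ℝ k fun x => Classical.choose hker (x - p)
    fun_prop
  have hψ : ContDiffAt ℝ k ψ (D.prodFun D.pt) :=
    ImplicitFunctionData.contDiffAt_implicitFunction (φ := D) hG hright.contDiffAt hk'
  have hev : ∀ᶠ q in 𝓝 (D.prodFun D.pt), ContDiffAt ℝ k ψ q ∧ ∀ᶠ q' in 𝓝 q, G (ψ q') = q'.1 :=
    (hψ.eventually (by simp)).and D.leftFun_implicitFunction.eventually_nhds
  have hcont : ContinuousAt D.prodFun D.pt := D.hasStrictFDerivAt.continuousAt
  -- The slice over the value 0 of the local inverse of (G, projection to the kernel).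
  refine ⟨fun s => ψ (0, L s), ?_⟩
  filter_upwards [hcont.eventually hev, D.implicitFunction_apply_image] with x hx hx' hGx
  have hq : D.prodFun x = ((0 : W), L (L.symm (D.rightFun x))) := by
    rw [ImplicitFunctionData.prodFun_apply, L.apply_symm_apply]
    exact Prod.ext hGx rfl
  have hx'' : ψ (D.prodFun x) = x := hx'
  rw [hq] at hx hx''
  have hLc : ContDiff ℝ k fun s : Fin m → ℝ => ((0 : W), L s) :=
    contDiff_const.prodMk L.contDiff
  refine ⟨L.symm (D.rightFun x), hx'', ContDiffAt.comp _ hx.1 hLc.contDiffAt, ?_⟩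
  exact hLc.continuous.continuousAt.eventually hx.2

/-! ### Flat charts and A. P. Morse's lemma -/

/-- A partial parametrization of a subset of `ℝ^n` by a subset of `ℝ^dim`. -/
structure MorseChart (n : ℕ) where
  /-- The dimension of the parameter space. -/
  dim : ℕ
  /-- The parameters. -/
  carrier : Set (Fin dim → ℝ)
  /-- The parametrization. -/
  toFun : (Fin dim → ℝ) → (Fin n → ℝ)

/-- A `C^1` chart into `A` along which every `C^k` function vanishing on `A` is flat to order `k`. -/
structure IsMorseChart {n : ℕ} (k : ℕ) (A : Set (Fin n → ℝ)) (c : MorseChart n) : Prop where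
  dim_le : c.dim ≤ n
  mapsTo : MapsTo c.toFun c.carrier A
  contDiffAt : ∀ y ∈ c.carrier, ContDiffAt ℝ 1 c.toFun y
  flat : ∀ (F : Type) [NormedAddCommGroup F] [NormedSpace ℝ F] (g : (Fin n → ℝ) → F),
    (∀ p ∈ A, ContDiffAt ℝ k g p) → (∀ p ∈ A, g p = 0) →
    ∀ y ∈ c.carrier, (fun x => g (c.toFun x)) =o[𝓝 y] fun x => ‖x - y‖ ^ k

/-- `A'` is covered by countably many charts which are flat for `A`. -/
def HasMorseCover {n : ℕ} (k : ℕ) (A A' : Set (Fin n → ℝ)) : Prop :=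
  ∃ S : Set (MorseChart n), S.Countable ∧ (∀ c ∈ S, IsMorseChart k A c) ∧
    A' ⊆ ⋃ c ∈ S, c.toFun '' c.carrier

theorem HasMorseCover.of_forall_nhds {n k : ℕ} {A A' : Set (Fin n → ℝ)}
    (h : ∀ p ∈ A', ∃ O ∈ 𝓝 p, HasMorseCover k A (A' ∩ O)) : HasMorseCover k A A' := by
  choose! O hO S hSc hS hcov using h
  obtain ⟨T, hTA, hTc, hT⟩ := TopologicalSpace.countable_cover_nhdsWithin (s := A') (f := O)
    fun p hp => mem_nhdsWithin_of_mem_nhds (hO p hp)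
  refine ⟨⋃ p ∈ T, S p, hTc.biUnion fun p hp => hSc p (hTA hp), fun c hc => ?_, fun x hx => ?_⟩
  · obtain ⟨p, hp, hc⟩ := mem_iUnion₂.1 hc
    exact hS p (hTA hp) c hc
  · obtain ⟨p, hp, hxp⟩ := mem_iUnion₂.1 (hT hx)
    obtain ⟨c, hc, hxc⟩ := mem_iUnion₂.1 (hcov p (hTA hp) ⟨hx, hxp⟩)
    exact mem_iUnion₂.2 ⟨c, mem_iUnion₂.2 ⟨p, hp, hc⟩, hxc⟩

theorem HasMorseCover.union {n k : ℕ} {A A₁ A₂ : Set (Fin n → ℝ)}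
    (h₁ : HasMorseCover k A A₁) (h₂ : HasMorseCover k A A₂) : HasMorseCover k A (A₁ ∪ A₂) := by
  obtain ⟨S₁, c₁, i₁, u₁⟩ := h₁
  obtain ⟨S₂, c₂, i₂, u₂⟩ := h₂
  refine ⟨S₁ ∪ S₂, c₁.union c₂, fun c hc => hc.elim (i₁ c) (i₂ c), ?_⟩
  rw [biUnion_union]
  exact union_subset_union u₁ u₂

/-- A cover of the parameters of a `C^k` map `φ` with values in `A` induces a cover of its image. -/
theorem HasMorseCover.image {n m k : ℕ} (hk : k ≠ 0) (hmn : m ≤ n) {A : Set (Fin n → ℝ)}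
    {D : Set (Fin m → ℝ)} {φ : (Fin m → ℝ) → (Fin n → ℝ)} (hφ : ∀ t ∈ D, ContDiffAt ℝ k φ t)
    (hmaps : MapsTo φ D A) (h : HasMorseCover k D D) : HasMorseCover k A (φ '' D) := by
  obtain ⟨S, hSc, hS, hcov⟩ := h
  have h1k : (1 : WithTop ℕ∞) ≤ k := by exact_mod_cast Nat.one_le_iff_ne_zero.2 hk
  refine ⟨(fun c : MorseChart m => ⟨c.dim, c.carrier, φ ∘ c.toFun⟩) '' S, hSc.image _, ?_, ?_⟩
  · rintro _ ⟨c, hc, rfl⟩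
    have hc := hS c hc
    refine ⟨hc.dim_le.trans hmn, hmaps.comp hc.mapsTo, fun y hy => ?_, fun F _ _ g hg hg0 y hy => ?_⟩
    · exact ((hφ _ (hc.mapsTo hy)).of_le h1k).comp y (hc.contDiffAt y hy)
    · exact hc.flat F (fun t => g (φ t)) (fun t ht => (hg _ (hmaps ht)).comp t (hφ t ht))
        (fun t ht => hg0 _ (hmaps ht)) y hy
  · rintro _ ⟨t, ht, rfl⟩
    obtain ⟨c, hc, y, hy, rfl⟩ := mem_iUnion₂.1 (hcov ht)
    exact mem_iUnion₂.2 ⟨_, mem_image_of_mem _ hc, y, hy, rfl⟩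

/-- If the derivatives of all `C^(k+1)` functions vanishing on `A` vanish on `A' ⊆ A`, then charts
which are flat to order `k` for `A'` are flat to order `k + 1` for `A`. -/
theorem HasMorseCover.succ {n k : ℕ} {A A' : Set (Fin n → ℝ)} (hA : A' ⊆ A)
    (hder : ∀ g : (Fin n → ℝ) → ℝ, (∀ p ∈ A, ContDiffAt ℝ (k + 1 : ℕ) g p) → (∀ p ∈ A, g p = 0) →
      ∀ p ∈ A', fderiv ℝ g p = 0)
    (h : HasMorseCover k A' A') : HasMorseCover (k + 1) A A' := by
  obtain ⟨S, hSc, hS, hcov⟩ := h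
  refine ⟨S, hSc, fun c hc => ?_, hcov⟩
  have hc := hS c hc
  refine ⟨hc.dim_le, hc.mapsTo.mono_right hA, hc.contDiffAt, fun F _ _ g hg hg0 y hy => ?_⟩
  have h1k : (1 : WithTop ℕ∞) ≤ (k + 1 : ℕ) := by exact_mod_cast Nat.le_add_left 1 k
  have hyA := hA (hc.mapsTo hy)
  have hzero : ∀ p ∈ A', fderiv ℝ g p = 0 := by
    intro p hp
    by_contra hne
    obtain ⟨v, hv⟩ : ∃ v, fderiv ℝ g p v ≠ 0 := by
      by_contra! hall
      exact hne (ContinuousLinearMap.ext hall)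
    -- `hder` speaks of scalar functions only; vector-valued `g` are reduced to it by a norming
    -- functional.
    obtain ⟨ℓ, -, hℓ⟩ := exists_dual_vector ℝ _ (norm_ne_zero_iff.2 hv)
    have hd := hder (fun x => ℓ (g x)) (fun q hq => ℓ.contDiff.contDiffAt.comp q (hg q hq))
      (fun q hq => by simp [hg0 q hq]) p hp
    have hgd : DifferentiableAt ℝ g p := (hg p (hA hp)).differentiableAt (by simp)
    have hcomp := (ℓ.hasFDerivAt.comp p hgd.hasFDerivAt).fderiv
    have hd' : fderiv ℝ (ℓ ∘ g) p = 0 := hd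
    rw [hd'] at hcomp
    have := DFunLike.congr_fun hcomp v
    simp only [zero_apply, ContinuousLinearMap.comp_apply, hℓ] at this
    exact hv (norm_eq_zero.1 this.symm)
  -- The derivative takes values in a space of linear maps; this is why `flat` quantifies over all
  -- targets `F`.
  have hfl := hc.flat _ (fderiv ℝ g)
    (fun p hp => (hg p (hA hp)).fderiv_right (m := k) (by norm_cast)) hzero y hy
  have := isLittleO_comp_sub_of_fderiv ((hg _ hyA).of_le h1k) (hc.contDiffAt y hy) hfl
  simpa [hg0 _ hyA] using this

/-- **A. P. Morse's lemma**: every subset of `ℝ^n` is covered by countably many charts along which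
the `C^k` functions vanishing on it are flat to order `k`. -/
theorem hasMorseCover_self (k : ℕ) : ∀ (n : ℕ) (A : Set (Fin n → ℝ)), HasMorseCover k A A := by
  induction k with
  | zero =>
    intro n A
    refine ⟨{⟨n, A, id⟩}, countable_singleton _, ?_, by simp⟩
    rintro _ rfl
    refine ⟨le_rfl, mapsTo_id A, fun y _ => contDiffAt_id, fun F _ _ g hg hg0 y hy => ?_⟩
    simp only [pow_zero, id]
    rw [Asymptotics.isLittleO_one_iff]
    have := (hg y hy).continuousAt.tendsto
    rwa [hg0 y hy] at this
  | succ k ihk =>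
    intro n
    induction n with
    | zero =>
      intro A
      refine HasMorseCover.succ Subset.rfl (fun g _ _ p _ => ?_) (ihk 0 A)
      exact Subsingleton.elim _ _
    | succ n ihn =>
      intro A
      -- On `A ∩ P` all derivatives vanish, and one order of flatness is gained from the case `k`.
      -- Near a point of `A` outside `P`, `A` lies in a regular hypersurface g = 0 parametrized by
      -- ℝ^n, and the induction on the dimension applies.
      let P : Set (Fin (n + 1) → ℝ) := {p | ∀ g : (Fin (n + 1) → ℝ) → ℝ,
        (∀ q ∈ A, ContDiffAt ℝ (k + 1 : ℕ) g q) → (∀ q ∈ A, g q = 0) → fderiv ℝ g p = 0}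
      suffices h : HasMorseCover (k + 1) A (A ∩ P ∪ A ∩ Pᶜ) by rwa [inter_union_compl] at h
      refine HasMorseCover.union ?_ ?_
      · exact HasMorseCover.succ inter_subset_left (fun g hg hg0 p hp => hp.2 g hg hg0)
          (ihk _ _)
      · refine HasMorseCover.of_forall_nhds fun p hp => ?_
        obtain ⟨hpA, hpP⟩ := hp
        simp only [P, mem_compl_iff, mem_ofPred_eq, not_forall] at hpP
        obtain ⟨g, hg, hg0, hgp⟩ := hpP
        have hsurj : Function.Surjective (fderiv ℝ g p) := by
          have : (fderiv ℝ g p : (Fin (n + 1) → ℝ) →ₗ[ℝ] ℝ) ≠ 0 := by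
            intro h0
            exact hgp (ContinuousLinearMap.coe_injective h0)
          exact LinearMap.surjective this
        obtain ⟨φ, hφ⟩ := exists_parametrization_of_surjective_fderiv (Nat.succ_ne_zero k)
          (hg p hpA) hsurj (m := n) (by simp)
        refine ⟨_, hφ, ?_⟩
        let D : Set (Fin n → ℝ) := {t | φ t ∈ A ∧ ContDiffAt ℝ (k + 1 : ℕ) φ t}
        have hcov := HasMorseCover.image (A := A) (Nat.succ_ne_zero k) (Nat.le_succ n)
          (fun t (ht : t ∈ D) => ht.2) (fun t ht => ht.1) (ihn D)
        obtain ⟨S, hSc, hS, hc⟩ := hcov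
        refine ⟨S, hSc, hS, Subset.trans ?_ hc⟩
        rintro x ⟨⟨hxA, -⟩, hx⟩
        obtain ⟨t, rfl, ht, -⟩ := hx (hg0 x hxA)
        exact ⟨t, ⟨hxA, ht⟩, rfl⟩

/-- **Morse–Sard theorem** for real functions: the critical values of a `C^N` function on `ℝ^n`,
`n ≤ N`, form a null set. -/
theorem volume_image_eq_zero_of_fderiv_eq_zero {n N : ℕ} (hN : N ≠ 0) (hn : n ≤ N)
    {h : (Fin n → ℝ) → ℝ} {A : Set (Fin n → ℝ)} (hA : ∀ p ∈ A, ContDiffAt ℝ N h p)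
    (hcrit : ∀ p ∈ A, fderiv ℝ h p = 0) : volume (h '' A) = 0 := by
  obtain ⟨k, rfl⟩ := Nat.exists_eq_succ_of_ne_zero hN
  obtain ⟨S, hSc, hS, hcov⟩ := hasMorseCover_self k n A
  have hsub : h '' A ⊆ ⋃ c ∈ S, (fun x => h (c.toFun x)) '' c.carrier := by
    rintro _ ⟨x, hx, rfl⟩
    obtain ⟨c, hc, y, hy, rfl⟩ := mem_iUnion₂.1 (hcov hx)
    exact mem_iUnion₂.2 ⟨c, hc, y, hy, rfl⟩
  refine measure_mono_null hsub ((measure_biUnion_null_iff hSc).2 fun c hc => ?_)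
  have hc := hS c hc
  refine volume_image_eq_zero_of_isLittleO fun y hy => ?_
  have h1k : (1 : WithTop ℕ∞) ≤ (k + 1 : ℕ) := by exact_mod_cast Nat.le_add_left 1 k
  -- With N = k + 1, the derivative is flat to order k, so h is flat to order N along the chart, and
  -- N is at least the dimension of the chart.
  have hfl := hc.flat _ (fderiv ℝ h)
    (fun p hp => (hA p hp).fderiv_right (m := k) (by norm_cast)) hcrit y hy
  refine (isLittleO_comp_sub_of_fderiv ((hA _ (hc.mapsTo hy)).of_le h1k) (hc.contDiffAt y hy)
    hfl).trans_isBigO ?_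
  refine Asymptotics.IsBigO.of_bound 1 ?_
  filter_upwards [Metric.ball_mem_nhds y one_pos] with x hx
  rw [Metric.mem_ball, dist_eq_norm] at hx
  rw [norm_pow, norm_norm, norm_pow, norm_norm, one_mul]
  exact pow_le_pow_of_le_one (norm_nonneg _) hx.le (hc.dim_le.trans hn)

end Sard

/-! ### The Clarke subdifferential of a locally Lipschitz function -/

section ClarkeCalculus

/-- In finite dimension, the convex hull of a compact set is compact. -/
theorem isCompact_convexHull_of_finiteDimensional {E : Type*} [NormedAddCommGroup E]
    [NormedSpace ℝ E] [FiniteDimensional ℝ E] {s : Set E} (hs : IsCompact s) :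
    IsCompact (convexHull ℝ s) := by
  -- Carathéodory: finrank + 1 points suffice, so the hull is a finite union of continuous images of
  -- compact sets.
  have heq : convexHull ℝ s = ⋃ j ∈ Finset.range (Module.finrank ℝ E + 2),
      (fun q : (Fin j → ℝ) × (Fin j → E) => ∑ i, q.1 i • q.2 i) ''
        (stdSimplex ℝ (Fin j) ×ˢ Set.pi univ fun _ => s) := by
    refine Subset.antisymm (fun x hx => ?_) ?_
    · obtain ⟨ι, _, z, w, hz, hind, hw, hw1, rfl⟩ := eq_pos_convex_span_of_mem_convexHull hx
      have e := Fintype.equivFin ι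
      refine mem_iUnion₂.2 ⟨Fintype.card ι, ?_, (fun i => w (e.symm i), fun i => z (e.symm i)),
        ⟨⟨fun i => (hw _).le, ?_⟩, fun i _ => hz (mem_range_self _)⟩, ?_⟩
      · have := hind.card_le_finrank_succ
        have h2 := Submodule.finrank_le (vectorSpan ℝ (range z))
        rw [Finset.mem_range]
        omega
      · rw [← hw1]
        exact e.symm.sum_comp w
      · exact e.symm.sum_comp fun i => w i • z i
    · refine iUnion₂_subset fun j _ => ?_
      rintro _ ⟨⟨w, z⟩, ⟨⟨hw, hw1⟩, hz⟩, rfl⟩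
      exact (convex_convexHull ℝ s).sum_mem (fun i _ => hw i) hw1
        fun i _ => subset_convexHull ℝ s (hz i (mem_univ _))
  rw [heq]
  refine (Finset.range _).isCompact_biUnion fun j _ => ?_
  refine ((isCompact_stdSimplex ℝ (Fin j)).prod (isCompact_univ_pi fun _ => hs)).image ?_
  fun_prop

variable {E : Type*} [NormedAddCommGroup E] [InnerProductSpace ℝ E]

section

variable [CompleteSpace E]

/-- The limits of gradients along sequences of differentiability points tending to `x`. -/
def limitingGradients (f : E → ℝ) (x : E) : Set E :=
  {v | ∃ u : ℕ → E, (∀ i, DifferentiableAt ℝ f (u i)) ∧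
    Tendsto u atTop (𝓝 x) ∧ Tendsto (fun i => gradient f (u i)) atTop (𝓝 v)}

theorem convex_clarkeSubdifferential (f : E → ℝ) (x : E) :
    Convex ℝ (clarkeSubdifferential f x) := convex_convexHull _ _

/-- A slice of the closure of the graph of the gradient, which makes closedness immediate. -/
theorem mem_limitingGradients_iff {f : E → ℝ} {x v : E} : v ∈ limitingGradients f x ↔
    (x, v) ∈ closure ((fun u => (u, gradient f u)) '' {u | DifferentiableAt ℝ f u}) := by
  rw [mem_closure_iff_seq_limit]
  constructor
  · rintro ⟨u, hu, hux, huv⟩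
    exact ⟨fun i => (u i, gradient f (u i)), fun i => ⟨u i, hu i, rfl⟩, hux.prodMk_nhds huv⟩
  · rintro ⟨q, hq, hlim⟩
    choose u hu hqu using hq
    obtain rfl : q = fun i => (u i, gradient f (u i)) := funext fun i => (hqu i).symm
    rw [nhds_prod_eq, tendsto_prod_iff'] at hlim
    exact ⟨u, hu, hlim⟩

theorem isClosed_limitingGradients (f : E → ℝ) (x : E) : IsClosed (limitingGradients f x) := by
  have : limitingGradients f x = (fun v => (x, v)) ⁻¹'
      closure ((fun u => (u, gradient f u)) '' {u | DifferentiableAt ℝ f u}) := by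
    ext v
    exact mem_limitingGradients_iff
  rw [this]
  exact isClosed_closure.preimage (by fun_prop)

theorem LocallyLipschitz.exists_eventually_norm_gradient_le {f : E → ℝ} (hf : LocallyLipschitz f)
    (x : E) : ∃ K : ℝ, ∀ᶠ u in 𝓝 x, ‖gradient f u‖ ≤ K := by
  obtain ⟨K, t, ht, hK⟩ := hf x
  refine ⟨K, (eventually_mem_nhds_iff.2 ht).mono fun u hu => ?_⟩
  have := norm_fderiv_le_of_lipschitzOn ℝ hu hK
  rwa [← toDual_gradient, LinearIsometryEquiv.norm_map] at this

end

variable [FiniteDimensional ℝ E] {f : E → ℝ}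

/-- By Rademacher's theorem a ball without differentiability points would be null. -/
theorem LocallyLipschitz.frequently_differentiableAt (hf : LocallyLipschitz f) (x : E) :
    ∃ᶠ u in 𝓝 x, DifferentiableAt ℝ f u := by
  borelize E
  obtain ⟨K, t, ht, hK⟩ := hf x
  intro hno
  obtain ⟨ε, hε, hball⟩ := Metric.mem_nhds_iff.1 (inter_mem ht hno)
  have hae := (hK.mono (hball.trans inter_subset_left)).ae_differentiableWithinAt_of_mem
    (μ := (volume : Measure E))
  have hzero : volume (Metric.ball x ε) = 0 := by
    refine measure_mono_null (fun u hu => ?_) hae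
    change ¬ (u ∈ Metric.ball x ε → DifferentiableWithinAt ℝ f (Metric.ball x ε) u)
    intro h
    exact (hball hu).2 ((h hu).differentiableAt (Metric.isOpen_ball.mem_nhds hu))
  exact (Metric.measure_ball_pos volume x hε).ne' hzero

variable [CompleteSpace E]

theorem LocallyLipschitz.exists_subseq_gradient (hf : LocallyLipschitz f) {x : E} {u : ℕ → E}
    (hu : ∀ i, DifferentiableAt ℝ f (u i)) (hux : Tendsto u atTop (𝓝 x)) :
    ∃ v ∈ limitingGradients f x, ∃ φ : ℕ → ℕ, StrictMono φ ∧
      Tendsto (fun i => gradient f (u (φ i))) atTop (𝓝 v) := by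
  obtain ⟨K, hK⟩ := hf.exists_eventually_norm_gradient_le x
  obtain ⟨v, -, φ, hφ, hv⟩ := tendsto_subseq_of_frequently_bounded
    (Metric.isBounded_closedBall (x := (0 : E)) (r := K))
    (x := fun i => gradient f (u i)) ((hux.eventually hK).mono fun i hi => by simpa using hi).frequently
  exact ⟨v, ⟨u ∘ φ, fun i => hu _, hux.comp hφ.tendsto_atTop, hv⟩, φ, hφ, hv⟩

theorem LocallyLipschitz.nonempty_clarkeSubdifferential (hf : LocallyLipschitz f) (x : E) :
    (clarkeSubdifferential f x).Nonempty := by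
  obtain ⟨u, hux, hu⟩ := exists_seq_forall_of_frequently (hf.frequently_differentiableAt x)
  obtain ⟨v, hv, -⟩ := hf.exists_subseq_gradient hu hux
  exact ⟨v, subset_convexHull ℝ _ hv⟩

/-- Gradients are bounded near `x`, so a sequence of counterexamples would have a limiting gradient
as a cluster value. This is the source of outer semicontinuity of the hull. -/
theorem LocallyLipschitz.eventually_gradient_mem_thickening (hf : LocallyLipschitz f) (x : E)
    {ε : ℝ} (hε : 0 < ε) : ∀ᶠ u in 𝓝 x, DifferentiableAt ℝ f u →
      gradient f u ∈ Metric.thickening ε (limitingGradients f x) := by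
  by_contra hno
  obtain ⟨u, hux, hu⟩ := exists_seq_forall_of_frequently (not_eventually.1 hno)
  simp only [Classical.not_imp] at hu
  obtain ⟨v, hv, φ, -, hφ⟩ := hf.exists_subseq_gradient (fun i => (hu i).1) hux
  have hmem : Metric.thickening ε (limitingGradients f x) ∈ 𝓝 v :=
    Metric.isOpen_thickening.mem_nhds (Metric.self_subset_thickening hε _ hv)
  obtain ⟨i, hi⟩ := (hφ.eventually hmem).exists
  exact (hu _).2 hi

theorem LocallyLipschitz.isCompact_clarkeSubdifferential (hf : LocallyLipschitz f) (x : E) :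
    IsCompact (clarkeSubdifferential f x) := by
  obtain ⟨K, hK⟩ := hf.exists_eventually_norm_gradient_le x
  refine isCompact_convexHull_of_finiteDimensional (Metric.isCompact_of_isClosed_isBounded
    (isClosed_limitingGradients f x) (Metric.isBounded_closedBall (x := (0 : E)) (r := K) |>.subset ?_))
  rintro v ⟨u, -, hux, huv⟩
  rw [mem_closedBall_zero_iff]
  exact le_of_tendsto huv.norm (hux.eventually hK)

/-- Outer semicontinuity of the Clarke subdifferential. -/
theorem LocallyLipschitz.eventually_clarkeSubdifferential_subset (hf : LocallyLipschitz f) (x : E)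
    {ε : ℝ} (hε : 0 < ε) : ∀ᶠ x' in 𝓝 x,
      clarkeSubdifferential f x' ⊆ Metric.cthickening ε (clarkeSubdifferential f x) := by
  filter_upwards [(hf.eventually_gradient_mem_thickening x hε).eventually_nhds] with x' hx'
  refine convexHull_min ?_ ((convex_clarkeSubdifferential f x).cthickening ε)
  rintro v ⟨u, hu, hux, huv⟩
  refine Metric.isClosed_cthickening.mem_of_tendsto huv ((hux.eventually hx').mono fun i hi => ?_)
  exact Metric.thickening_subset_cthickening _ _ (Metric.thickening_subset_of_subset ε
    (subset_convexHull ℝ _) (hi (hu i)))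

/-- The graph of the Clarke subdifferential is closed. -/
theorem LocallyLipschitz.mem_clarkeSubdifferential_of_tendsto (hf : LocallyLipschitz f)
    {ι : Type*} {l : Filter ι} [l.NeBot] {x v : ι → E} {x' v' : E} (hx : Tendsto x l (𝓝 x'))
    (hv : Tendsto v l (𝓝 v')) (h : ∀ᶠ i in l, v i ∈ clarkeSubdifferential f (x i)) :
    v' ∈ clarkeSubdifferential f x' := by
  rw [← (hf.isCompact_clarkeSubdifferential x').isClosed.closure_eq,
    Metric.closure_eq_iInter_cthickening]
  refine mem_iInter₂.2 fun ε hε => Metric.isClosed_cthickening.mem_of_tendsto hv ?_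
  filter_upwards [h, hx.eventually (hf.eventually_clarkeSubdifferential_subset x' hε)] with i h1 h2
  exact h2 h1

theorem LocallyLipschitz.exists_norm_clarkeSubdifferential_le (hf : LocallyLipschitz f)
    {S : Set E} (hS : IsCompact S) :
    ∃ C : ℝ, ∀ x ∈ S, ∀ v ∈ clarkeSubdifferential f x, ‖v‖ ≤ C := by
  refine hS.induction_on (p := fun S => ∃ C : ℝ, ∀ x ∈ S, ∀ v ∈ clarkeSubdifferential f x, ‖v‖ ≤ C)
    ⟨0, by simp⟩ (fun s t hst ⟨C, hC⟩ => ⟨C, fun x hx => hC x (hst hx)⟩) ?_ ?_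
  · rintro s t ⟨C, hC⟩ ⟨C', hC'⟩
    exact ⟨max C C', fun x hx v hv => hx.elim (fun h => (hC x h v hv).trans (le_max_left _ _))
      fun h => (hC' x h v hv).trans (le_max_right _ _)⟩
  · intro x _
    obtain ⟨C, hC⟩ := (hf.isCompact_clarkeSubdifferential x).isBounded.cthickening
      (δ := 1) |>.exists_norm_le
    exact ⟨_, mem_nhdsWithin_of_mem_nhds (hf.eventually_clarkeSubdifferential_subset x one_pos),
      C, fun x' hx' v hv => hC v (hx' hv)⟩

/-- Near a noncritical point, the subgradients are bounded away from zero. -/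
theorem LocallyLipschitz.exists_eventually_le_norm (hf : LocallyLipschitz f) {x : E}
    (hx : ¬ IsClarkeCritical f x) :
    ∃ c > 0, ∀ᶠ x' in 𝓝 x, ∀ v ∈ clarkeSubdifferential f x', c ≤ ‖v‖ := by
  have hpos : 0 < Metric.infDist 0 (clarkeSubdifferential f x) :=
    ((hf.isCompact_clarkeSubdifferential x).isClosed.notMem_iff_infDist_pos
      (hf.nonempty_clarkeSubdifferential x)).1 hx
  set δ := Metric.infDist 0 (clarkeSubdifferential f x)
  refine ⟨δ / 2, by positivity, ?_⟩
  filter_upwards [hf.eventually_clarkeSubdifferential_subset x (half_pos hpos)] with x' hx' v hv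
  have h1 : Metric.infDist v (clarkeSubdifferential f x) ≤ δ / 2 :=
    ENNReal.toReal_le_of_le_ofReal (half_pos hpos).le (Metric.mem_cthickening_iff.1 (hx' hv))
  have h2 := Metric.infDist_le_infDist_add_dist (s := clarkeSubdifferential f x)
    (x := (0 : E)) (y := v)
  rw [dist_zero_left] at h2
  change δ ≤ _ at h2
  linarith

end ClarkeCalculus

/-! ### Strata: tangent vectors, chain rule and critical values -/

section Strata

variable {H : Type*} [NormedAddCommGroup H] [InnerProductSpace ℝ H]

theorem IsLocalDefiningMap.apply_eq_zero_iff {p m : ℕ} {M U : Set H} {x y : H}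
    {F : H → EuclideanSpace ℝ (Fin m)} (h : IsLocalDefiningMap p M x U F) (hy : y ∈ U) :
    F y = 0 ↔ y ∈ M := by
  have := Set.ext_iff.1 h.inter_eq y
  exact ⟨fun h0 => (this.2 ⟨hy, h0⟩).1, fun hM => (this.1 ⟨hM, hy⟩).2⟩

theorem IsLocalDefiningMap.contDiffAt {p m : ℕ} {M U : Set H} {x : H}
    {F : H → EuclideanSpace ℝ (Fin m)} (h : IsLocalDefiningMap p M x U F) : ContDiffAt ℝ p F x :=
  h.contDiffOn.contDiffAt (h.isOpen.mem_nhds h.mem)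

/-- The velocity of a curve that accumulates in `M` at a point of `M` is tangent to `M`. -/
theorem IsLocalDefiningMap.fderiv_apply_eq_zero {p m : ℕ} (hp : p ≠ 0) {M U : Set H}
    {F : H → EuclideanSpace ℝ (Fin m)} {Γ : ℝ → H} {w : H} {t : ℝ}
    (h : IsLocalDefiningMap p M (Γ t) U F) (hΓ : HasDerivAt Γ w t) (ht : Γ t ∈ M)
    (hacc : AccPt t (𝓟 (Γ ⁻¹' M))) : fderiv ℝ F (Γ t) w = 0 := by
  have hF : DifferentiableAt ℝ F (Γ t) := h.contDiffAt.differentiableAt (by exact_mod_cast hp)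
  have h1 : HasDerivWithinAt (F ∘ Γ) (fderiv ℝ F (Γ t) w) (Γ ⁻¹' M) t :=
    (hF.hasFDerivAt.comp_hasDerivAt t hΓ).hasDerivWithinAt
  have hz : ∀ᶠ s in 𝓝[Γ ⁻¹' M] t, (F ∘ Γ) s = 0 := by
    filter_upwards [self_mem_nhdsWithin, mem_nhdsWithin_of_mem_nhds
      (hΓ.continuousAt.preimage_mem_nhds (h.isOpen.mem_nhds h.mem))] with s hs hsU
    exact (h.apply_eq_zero_iff hsU).2 hs
  have h2 : HasDerivWithinAt (F ∘ Γ) 0 (Γ ⁻¹' M) t :=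
    (hasDerivWithinAt_const t (Γ ⁻¹' M) (0 : EuclideanSpace ℝ (Fin m))).congr_of_eventuallyEq hz
      ((h.apply_eq_zero_iff h.mem).2 ht)
  -- `F ∘ Γ` vanishes on `Γ ⁻¹' M` near `t`, and derivatives within a set are unique at its
  -- accumulation points.
  exact hacc.uniqueDiffWithinAt.eq_deriv _ h1 h2

theorem mem_tangentSpaceAt_of_accPt {p : ℕ} (hp : p ≠ 0) {M : Set H} (hM : IsSmoothManifold p M)
    {Γ : ℝ → H} {w : H} {t : ℝ} (hΓ : HasDerivAt Γ w t) (ht : Γ t ∈ M)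
    (hacc : AccPt t (𝓟 (Γ ⁻¹' M))) : w ∈ tangentSpaceAt p M (Γ t) := by
  obtain ⟨r, m, -, hloc⟩ := hM
  obtain ⟨U, F, hF⟩ := hloc _ ht
  exact ⟨m, U, F, hF, hF.fderiv_apply_eq_zero hp hΓ ht hacc⟩

/-- Every tangent vector is the velocity of a curve in the manifold. -/
theorem exists_curve_of_mem_tangentSpaceAt [FiniteDimensional ℝ H] {p : ℕ} (hp : p ≠ 0)
    {M : Set H} {x w : H} (hx : x ∈ M) (hw : w ∈ tangentSpaceAt p M x) :
    ∃ Γ : ℝ → H, Γ 0 = x ∧ HasDerivAt Γ w 0 ∧ ∀ᶠ s in 𝓝 0, Γ s ∈ M := by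
  obtain ⟨m, U, F, hF, hFw⟩ := hw
  have := FiniteDimensional.complete ℝ H
  have hstrict : HasStrictFDerivAt F (fderiv ℝ F x) x :=
    hF.contDiffAt.hasStrictFDerivAt (by exact_mod_cast hp)
  have hrange : (fderiv ℝ F x).range = ⊤ := LinearMap.range_eq_top.2 hF.full_rank
  have hFx : F x = 0 := (hF.apply_eq_zero_iff hF.mem).2 hx
  let w' : (fderiv ℝ F x).ker := ⟨w, hFw⟩
  let φ := hstrict.implicitFunction F (fderiv ℝ F x) hrange
  have hφ : HasStrictFDerivAt (φ (F x)) (fderiv ℝ F x).ker.subtypeL 0 :=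
    hstrict.to_implicitFunction hrange
  have hφ0 : φ (F x) 0 = x := hstrict.implicitFunction_apply_image hrange
  have hlin : HasDerivAt (fun s : ℝ => s • w') w' 0 := by
    simpa using (hasDerivAt_id (0 : ℝ)).smul_const w'
  have hder : HasDerivAt (fun s : ℝ => φ (F x) (s • w')) w 0 := by
    have h1 : HasFDerivAt (φ (F x)) (fderiv ℝ F x).ker.subtypeL ((0 : ℝ) • w') := by
      rw [zero_smul]; exact hφ.hasFDerivAt
    exact h1.comp_hasDerivAt (0 : ℝ) hlin
  refine ⟨fun s => φ (F x) (s • w'), by simp [hφ0], hder, ?_⟩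
  have hU : ∀ᶠ s in 𝓝 (0 : ℝ), φ (F x) (s • w') ∈ U :=
    hder.continuousAt.eventually_mem (hF.isOpen.mem_nhds (by simpa [hφ0] using hF.mem))
  have hpair : Tendsto (fun s : ℝ => (F x, s • w')) (𝓝 0) (𝓝 (F x, 0)) := by
    have : Continuous fun s : ℝ => (F x, s • w') := by fun_prop
    simpa using this.tendsto 0
  filter_upwards [hU, hpair.eventually (hstrict.map_implicitFunction_eq hrange)] with s hs hs'
  exact (hF.apply_eq_zero_iff hs).1 (hs'.trans hFx)

theorem convex_normalSpaceAt (p : ℕ) (M : Set H) (x : H) : Convex ℝ (normalSpaceAt p M x) := by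
  intro v hv v' hv' a b _ _ _ w hw
  rw [inner_add_left, inner_smul_left, inner_smul_left, hv w hw, hv' w hw]
  simp

variable {E : Type*} [NormedAddCommGroup E] [InnerProductSpace ℝ E]

section

variable {f : E → ℝ} {p : ℕ} {A : Set (Set (WithLp 2 (E × ℝ)))}

theorem IsWhitneyStratification.subset_graph (hA : IsWhitneyStratification p (euclideanGraph f) A)
    {M : Set (WithLp 2 (E × ℝ))} (hM : M ∈ A) : M ⊆ euclideanGraph f :=
  hA.sUnion_eq ▸ subset_sUnion_of_mem hM

theorem IsWhitneyStratification.exists_mem (hA : IsWhitneyStratification p (euclideanGraph f) A)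
    (x : E) : ∃ M ∈ A, WithLp.toLp 2 (x, f x) ∈ M := by
  have : WithLp.toLp 2 (x, f x) ∈ ⋃₀ A := hA.sUnion_eq ▸ mem_range_self x
  exact this
end

variable [FiniteDimensional ℝ E]

theorem finrank_withLp_prod_real :
    Module.finrank ℝ (WithLp 2 (E × ℝ)) = Module.finrank ℝ E + 1 := by
  rw [(WithLp.linearEquiv 2 ℝ (E × ℝ)).finrank_eq, Module.finrank_prod, Module.finrank_self]

/-- A curve in `M` has the form (γ, f ∘ γ), so by differentiability at `u` its velocity is (a,
⟨∇f(u), a⟩), which is orthogonal to (∇f(u), -1). -/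
theorem toLp_gradient_mem_normalSpaceAt [CompleteSpace E] {f : E → ℝ} {p : ℕ} (hp : p ≠ 0)
    {M : Set (WithLp 2 (E × ℝ))} (hM : M ⊆ euclideanGraph f) {u : E}
    (hu : DifferentiableAt ℝ f u) (hz : WithLp.toLp 2 (u, f u) ∈ M) :
    WithLp.toLp 2 (gradient f u, (-1 : ℝ)) ∈ normalSpaceAt p M (WithLp.toLp 2 (u, f u)) := by
  intro w hw
  obtain ⟨Γ, hΓ0, hΓ, hΓM⟩ := exists_curve_of_mem_tangentSpaceAt hp hz hw
  have h1 : HasDerivAt (fun s => (Γ s).fst) w.fst 0 :=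
    (WithLp.fstL 2 ℝ E ℝ).hasFDerivAt.comp_hasDerivAt (0 : ℝ) hΓ
  have h2 : HasDerivAt (fun s => (Γ s).snd) w.snd 0 :=
    (WithLp.sndL 2 ℝ E ℝ).hasFDerivAt.comp_hasDerivAt (0 : ℝ) hΓ
  have hu' : HasFDerivAt f (fderiv ℝ f u) (Γ 0).fst := by rw [hΓ0]; exact hu.hasFDerivAt
  have h3 : HasDerivAt (fun s => f (Γ s).fst) (fderiv ℝ f u w.fst) 0 :=
    hu'.comp_hasDerivAt (0 : ℝ) h1
  have heq : (fun s => (Γ s).snd) =ᶠ[𝓝 0] fun s => f (Γ s).fst := by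
    filter_upwards [hΓM] with s hs
    obtain ⟨a, ha⟩ := hM hs
    rw [← ha]
    rfl
  have h4 := h2.unique (h3.congr_of_eventuallyEq heq)
  rw [WithLp.prod_inner_apply]
  have h5 : inner ℝ (gradient f u) w.fst = fderiv ℝ f u w.fst := by
    rw [← toDual_gradient]; rfl
  change inner ℝ (gradient f u) w.fst + inner ℝ (-1 : ℝ) w.snd = 0
  rw [h5, h4]
  simp

variable {f : E → ℝ} {p : ℕ} {A : Set (Set (WithLp 2 (E × ℝ)))}

/-- The projection formula: subgradients give normal vectors to the strata of the graph. -/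
theorem IsWhitneyStratification.toLp_mem_normalSpaceAt [CompleteSpace E] (hp : p ≠ 0)
    (hf : Continuous f) (hA : IsWhitneyStratification p (euclideanGraph f) A) {x v : E}
    {L : Set (WithLp 2 (E × ℝ))} (hL : L ∈ A) (hx : WithLp.toLp 2 (x, f x) ∈ L)
    (hv : v ∈ clarkeSubdifferential f x) :
    WithLp.toLp 2 (v, (-1 : ℝ)) ∈ normalSpaceAt p L (WithLp.toLp 2 (x, f x)) := by
  have hconv : Convex ℝ {v : E | WithLp.toLp 2 (v, (-1 : ℝ)) ∈
      normalSpaceAt p L (WithLp.toLp 2 (x, f x))} := by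
    intro v hv v' hv' a b ha hb hab
    have := convex_normalSpaceAt p L (WithLp.toLp 2 (x, f x)) hv hv' ha hb hab
    rw [← WithLp.toLp_smul, ← WithLp.toLp_smul, ← WithLp.toLp_add] at this
    have h1 : a • (v, (-1 : ℝ)) + b • (v', (-1 : ℝ)) = (a • v + b • v', (-1 : ℝ)) := by
      ext
      · simp
      · simp only [Prod.snd_add, Prod.smul_snd, smul_eq_mul]; linarith
    rwa [h1] at this
  refine convexHull_min ?_ hconv hv
  rintro v ⟨u, hu, hux, huv⟩
  -- Finitely many strata: one of them contains infinitely many of the graph points, and Whitney's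
  -- condition (a) applies along it.
  obtain ⟨M, hM, hfreq⟩ : ∃ M ∈ A, ∃ᶠ i in atTop, WithLp.toLp 2 (u i, f (u i)) ∈ M := by
    by_contra! hno
    obtain ⟨i, hi⟩ := ((eventually_all_finite hA.finite).2 hno).exists
    obtain ⟨M, hM, hmem⟩ := hA.exists_mem (u i)
    exact hi M hM hmem
  obtain ⟨φ, hφ, hφM⟩ := extraction_of_frequently_atTop hfreq
  have hc : Continuous fun x : E => WithLp.toLp 2 (x, f x) := by
    exact (WithLp.prod_continuous_toLp 2 E ℝ).comp (continuous_id.prodMk hf)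
  have hc' : Continuous fun v : E => WithLp.toLp 2 (v, (-1 : ℝ)) :=
    (WithLp.prod_continuous_toLp 2 E ℝ).comp (continuous_id.prodMk continuous_const)
  refine hA.whitney_a L hL M hM (fun i => WithLp.toLp 2 (u (φ i), f (u (φ i))))
    (fun i => WithLp.toLp 2 (gradient f (u (φ i)), (-1 : ℝ))) _ _ hφM hx
    ((hc.tendsto x).comp (hux.comp hφ.tendsto_atTop)) (fun i => ?_)
    ((hc'.tendsto v).comp (huv.comp hφ.tendsto_atTop))
  exact toLp_gradient_mem_normalSpaceAt hp (hA.subset_graph hM) (hu _) (hφM i)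

/-- Such points are isolated from the right in `I`, and a set of reals has only countably many of
these. -/
theorem countable_setOf_mem_not_accPt (I : Set ℝ) : {t | t ∈ I ∧ ¬ AccPt t (𝓟 I)}.Countable := by
  refine (countable_setOfPred_isolated_right_within (s := I)).mono ?_
  rintro t ht
  refine ⟨ht.1, ?_⟩
  by_contra hne
  refine ht.2 ?_
  rw [AccPt, nhdsWithin, inf_assoc, inf_principal]
  refine neBot_iff.2 (ne_bot_of_le_ne_bot hne (nhdsWithin_mono t ?_))
  exact fun s hs => ⟨fun h => (ne_of_gt hs.2) h, hs.1⟩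

/-- The chain rule along curves for functions with a Whitney stratifiable graph. -/
theorem IsWhitneyStratification.ae_deriv_comp_eq [CompleteSpace E] (hp : p ≠ 0)
    (hf : Continuous f) (hA : IsWhitneyStratification p (euclideanGraph f) A) (γ : ℝ → E) :
    ∀ᵐ t : ℝ, DifferentiableAt ℝ γ t → DifferentiableAt ℝ (fun s => f (γ s)) t →
      ∀ v ∈ clarkeSubdifferential f (γ t),
        deriv (fun s => f (γ s)) t = inner ℝ v (deriv γ t) := by
  set Γ : ℝ → WithLp 2 (E × ℝ) := fun s => WithLp.toLp 2 (γ s, f (γ s)) with hΓdef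
  have hcount : (⋃ M ∈ A, {t | t ∈ Γ ⁻¹' M ∧ ¬ AccPt t (𝓟 (Γ ⁻¹' M))}).Countable :=
    hA.finite.countable.biUnion fun M _ => countable_setOf_mem_not_accPt _
  filter_upwards [hcount.ae_notMem volume] with t ht hγ hfγ v hv
  obtain ⟨M, hM, hmem⟩ := hA.exists_mem (γ t)
  have hacc : AccPt t (𝓟 (Γ ⁻¹' M)) := by
    by_contra hno
    exact ht (mem_iUnion₂.2 ⟨M, hM, hmem, hno⟩)
  have hΓ : HasDerivAt Γ (WithLp.toLp 2 (deriv γ t, deriv (fun s => f (γ s)) t)) t :=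
    (WithLp.prodContinuousLinearEquiv 2 ℝ E ℝ).symm.hasFDerivAt.comp_hasDerivAt t
      (hγ.hasDerivAt.prodMk hfγ.hasDerivAt)
  -- The velocity (γ', (f ∘ γ)') is tangent and (v, -1) is normal; their orthogonality is the chain
  -- rule.
  have htan := mem_tangentSpaceAt_of_accPt hp (hA.manifold M hM) hΓ hmem hacc
  have hnor := hA.toLp_mem_normalSpaceAt hp hf hM hmem hv _ htan
  rw [WithLp.prod_inner_apply] at hnor
  simp at hnor
  linarith

/-- The heights of the points of a stratum at which the height is critical form a null set. -/
theorem IsSmoothManifold.volume_image_snd_eq_zero {M : Set (WithLp 2 (E × ℝ))} (hp : p ≠ 0)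
    (hpE : Module.finrank ℝ E ≤ p) (hM : IsSmoothManifold p M) :
    volume (WithLp.snd '' {z | z ∈ M ∧
      WithLp.toLp 2 ((0 : E), (-1 : ℝ)) ∈ normalSpaceAt p M z}) = 0 := by
  set S := {z | z ∈ M ∧ WithLp.toLp 2 ((0 : E), (-1 : ℝ)) ∈ normalSpaceAt p M z} with hS
  have key : ∀ z ∈ S, ∃ O ∈ 𝓝 z, volume (WithLp.snd '' (S ∩ O)) = 0 := by
    rintro z ⟨hzM, hzN⟩
    obtain ⟨r, m, hrm, hloc⟩ := id hM
    obtain ⟨U, F, hF⟩ := hloc z hzM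
    -- In codimension 0 the vertical vector (0, 1) would be tangent, against normality of (0, -1).
    -- Hence the codimension is positive and r ≤ d ≤ p, exactly what Morse–Sard requires.
    have hr : r ≤ p := by
      rcases Nat.eq_zero_or_pos m with rfl | hm
      · have hw : WithLp.toLp 2 ((0 : E), (1 : ℝ)) ∈ tangentSpaceAt p M z :=
          ⟨0, U, F, hF, Subsingleton.elim _ _⟩
        have := hzN _ hw
        rw [WithLp.prod_inner_apply] at this
        simp at this
      · rw [finrank_withLp_prod_real] at hrm
        omega
    obtain ⟨φ, hφ⟩ := exists_parametrization_of_surjective_fderiv hp hF.contDiffAt hF.full_rank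
      (m := r) (by rw [← hrm, finrank_euclideanSpace_fin])
    refine ⟨U ∩ _, inter_mem (hF.isOpen.mem_nhds hF.mem) (inter_mem hφ
      (eventually_mem_nhds_iff.2 (hF.isOpen.mem_nhds hF.mem))), ?_⟩
    let D : Set (Fin r → ℝ) := {t | ContDiffAt ℝ p φ t ∧
      fderiv ℝ (fun s => (φ s).snd) t = 0}
    refine measure_mono_null ?_ (volume_image_eq_zero_of_fderiv_eq_zero (A := D)
      (h := fun s => (φ s).snd) hp hr (fun t ht => ?_) fun t ht => ht.2)
    · rintro _ ⟨z', ⟨⟨hz'M, hz'N⟩, hz'U, hz'φ, hz'V⟩, rfl⟩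
      obtain ⟨t, rfl, ht, htF⟩ := hz'φ ((hF.apply_eq_zero_iff hz'U).2 hz'M)
      refine ⟨t, ⟨ht, ?_⟩, rfl⟩
      have hd : DifferentiableAt ℝ φ t := ht.differentiableAt (by exact_mod_cast hp)
      have hd' : HasFDerivAt (fun s => (φ s).snd)
          ((WithLp.sndL 2 ℝ E ℝ).comp (fderiv ℝ φ t)) t :=
        (WithLp.sndL 2 ℝ E ℝ).hasFDerivAt.comp t hd.hasFDerivAt
      rw [hd'.fderiv]
      ext1 w
      have hline : HasDerivAt (fun s : ℝ => t + s • w) w 0 := by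
        simpa using ((hasDerivAt_id (0 : ℝ)).smul_const w).const_add t
      have hcurve : HasDerivAt (fun s : ℝ => φ (t + s • w)) (fderiv ℝ φ t w) 0 := by
        have h1 : HasFDerivAt φ (fderiv ℝ φ t) (t + (0 : ℝ) • w) := by simpa using hd.hasFDerivAt
        exact h1.comp_hasDerivAt (0 : ℝ) hline
      have hinM : ∀ᶠ s in 𝓝 (0 : ℝ), φ (t + s • w) ∈ M := by
        have hl : Tendsto (fun s : ℝ => t + s • w) (𝓝 0) (𝓝 t) := by
          simpa using hline.continuousAt.tendsto
        have hU : ∀ᶠ s in 𝓝 t, φ s ∈ U := hd.continuousAt.eventually_mem hz'V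
        filter_upwards [hl.eventually htF, hl.eventually hU] with s h1 h2
        exact (hF.apply_eq_zero_iff h2).1 h1
      have htan := mem_tangentSpaceAt_of_accPt hp hM hcurve (by simpa using hz'M)
        (by
          rw [accPt_iff_frequently_nhdsNE]
          exact (eventually_nhdsWithin_of_eventually_nhds hinM).frequently)
      have := hz'N (fderiv ℝ φ t w) (by simpa using htan)
      rw [WithLp.prod_inner_apply] at this
      simpa using this
    · exact (WithLp.sndL 2 ℝ E ℝ).contDiff.contDiffAt.comp t ht.1
  choose! O hO hO' using key
  obtain ⟨T, hTS, hTc, hT⟩ := TopologicalSpace.countable_cover_nhdsWithin (s := S) (f := O)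
    fun z hz => mem_nhdsWithin_of_mem_nhds (hO z hz)
  have hsub : WithLp.snd '' S ⊆ ⋃ z ∈ T, WithLp.snd '' (S ∩ O z) := by
    rintro _ ⟨z, hz, rfl⟩
    obtain ⟨q, hq, hzq⟩ := mem_iUnion₂.1 (hT hz)
    exact mem_iUnion₂.2 ⟨q, hq, z, ⟨hz, hzq⟩, rfl⟩
  exact measure_mono_null hsub ((measure_biUnion_null_iff hTc).2 fun z hz => hO' z (hTS hz))

/-- The Clarke critical values form a null set. -/
theorem IsWhitneyStratification.volume_image_critical_eq_zero [CompleteSpace E] (hp : p ≠ 0)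
    (hpE : Module.finrank ℝ E ≤ p) (hf : Continuous f)
    (hA : IsWhitneyStratification p (euclideanGraph f) A) :
    volume (f '' {x | IsClarkeCritical f x}) = 0 := by
  refine measure_mono_null (t := ⋃ M ∈ A, WithLp.snd '' {z | z ∈ M ∧
      WithLp.toLp 2 ((0 : E), (-1 : ℝ)) ∈ normalSpaceAt p M z}) ?_
    ((measure_biUnion_null_iff hA.finite.countable).2 fun M hM =>
      (hA.manifold M hM).volume_image_snd_eq_zero hp hpE)
  rintro _ ⟨x, hx, rfl⟩
  obtain ⟨M, hM, hmem⟩ := hA.exists_mem x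
  exact mem_iUnion₂.2 ⟨M, hM, _, ⟨hmem, hA.toLp_mem_normalSpaceAt hp hf hM hmem hx⟩, rfl⟩

end Strata

/-! ### Limit arcs of subgradient sequences -/

section LimitArcs

/-- The time elapsed after `n` steps. -/
def elapsedTime (α : ℕ → ℝ) (n : ℕ) : ℝ := ∑ i ∈ Finset.range n, α i

theorem elapsedTime_succ (α : ℕ → ℝ) (n : ℕ) :
    elapsedTime α (n + 1) = elapsedTime α n + α n := Finset.sum_range_succ _ _

theorem monotone_elapsedTime {α : ℕ → ℝ} (hα : ∀ n, 0 ≤ α n) : Monotone (elapsedTime α) :=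
  monotone_nat_of_le_succ fun n => by rw [elapsedTime_succ]; linarith [hα n]

/-- The first index after `k` at which at least the time `t` has elapsed since step `k`. -/
noncomputable def stepIndex (α : ℕ → ℝ) (k : ℕ) (t : ℝ) : ℕ :=
  sInf {n | k ≤ n ∧ elapsedTime α k + t ≤ elapsedTime α n}

variable {α : ℕ → ℝ}

theorem stepIndex_mem (hα : Tendsto (elapsedTime α) atTop atTop) (k : ℕ) (t : ℝ) :
    k ≤ stepIndex α k t ∧ elapsedTime α k + t ≤ elapsedTime α (stepIndex α k t) :=
  Nat.sInf_mem (s := {n | k ≤ n ∧ elapsedTime α k + t ≤ elapsedTime α n})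
    ((eventually_ge_atTop k).and (hα.eventually_ge_atTop _)).exists

theorem stepIndex_le {k n : ℕ} {t : ℝ} (h : k ≤ n)
    (h' : elapsedTime α k + t ≤ elapsedTime α n) : stepIndex α k t ≤ n :=
  Nat.sInf_le ⟨h, h'⟩

theorem stepIndex_zero (hα : Tendsto (elapsedTime α) atTop atTop) (k : ℕ) :
    stepIndex α k 0 = k :=
  le_antisymm (stepIndex_le le_rfl (by simp)) (stepIndex_mem hα k 0).1

theorem stepIndex_mono (hα : Tendsto (elapsedTime α) atTop atTop) (k : ℕ) {s t : ℝ} (hst : s ≤ t) :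
    stepIndex α k s ≤ stepIndex α k t :=
  stepIndex_le (stepIndex_mem hα k t).1 (by linarith [(stepIndex_mem hα k t).2])

/-- The stopping index overshoots the time `t` by at most one step, and steps vanish. A negative `t`
stops at once, whence `max t 0`. -/
theorem tendsto_elapsedTime_stepIndex (h0 : ∀ n, 0 ≤ α n) (hlim : Tendsto α atTop (𝓝 0))
    (hα : Tendsto (elapsedTime α) atTop atTop) (t : ℝ) :
    Tendsto (fun k => elapsedTime α (stepIndex α k t) - elapsedTime α k) atTop (𝓝 (max t 0)) := by
  rw [Metric.tendsto_atTop]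
  intro ε hε
  obtain ⟨N, hN⟩ := eventually_atTop.1 (hlim.eventually_lt_const hε)
  refine ⟨N, fun k hk => ?_⟩
  obtain ⟨h1, h2⟩ := stepIndex_mem hα k t
  have h3 := monotone_elapsedTime h0 h1
  have hlow : max t 0 ≤ elapsedTime α (stepIndex α k t) - elapsedTime α k :=
    max_le (by linarith) (by linarith)
  rw [Real.dist_eq, abs_of_nonneg (by linarith)]
  rcases h1.eq_or_lt with heq | hlt
  · rw [← heq, sub_self]
    linarith [le_max_right t 0]
  · obtain ⟨j, hj⟩ := Nat.exists_eq_succ_of_ne_zero (Nat.ne_zero_of_lt hlt)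
    have hkj : k ≤ j := by omega
    have hlt' : elapsedTime α j < elapsedTime α k + t := by
      by_contra! hge
      have := stepIndex_le hkj hge
      omega
    have := hN j (hk.trans hkj)
    rw [hj, Nat.succ_eq_add_one, elapsedTime_succ]
    linarith [le_max_left t 0]

variable {E : Type*} [NormedAddCommGroup E] [InnerProductSpace ℝ E] [CompleteSpace E]

/-- A bounded sequence of steps along bounded directions `y n`, with step sizes that tend to zero
and are not summable, whose directions are asymptotically negative subgradients. -/
structure IsAsymptoticSubgradientSequence (f : E → ℝ) (α : ℕ → ℝ) (x y : ℕ → E) (R C : ℝ) :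
    Prop where
  step : ∀ n, x (n + 1) = x n + α n • y n
  nonneg : ∀ n, 0 ≤ α n
  tendsto_zero : Tendsto α atTop (𝓝 0)
  tendsto_time : Tendsto (elapsedTime α) atTop atTop
  norm_le : ∀ n, ‖x n‖ ≤ R
  norm_direction_le : ∀ n, ‖y n‖ ≤ C
  neg_mem : ∀ (l : Ultrafilter ℕ) (z v : E), (l : Filter ℕ) ≤ atTop → Tendsto x l (𝓝 z) →
    Tendsto y l (𝓝 v) → -v ∈ clarkeSubdifferential f z

namespace IsAsymptoticSubgradientSequence

variable {f : E → ℝ} {x y : ℕ → E} {R C : ℝ}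

theorem bound_nonneg (h : IsAsymptoticSubgradientSequence f α x y R C) : 0 ≤ C :=
  (norm_nonneg _).trans (h.norm_direction_le 0)

theorem sub_eq_sum (h : IsAsymptoticSubgradientSequence f α x y R C) {m n : ℕ} (hmn : m ≤ n) :
    x n - x m = ∑ i ∈ Finset.Ico m n, α i • y i := by
  induction n, hmn using Nat.le_induction with
  | base => simp
  | succ n hmn ih => rw [Finset.sum_Ico_succ_top hmn, ← ih, h.step]; abel

theorem elapsedTime_sub_eq_sum {m n : ℕ} (hmn : m ≤ n) :
    elapsedTime α n - elapsedTime α m = ∑ i ∈ Finset.Ico m n, α i :=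
  (Finset.sum_Ico_eq_sub _ hmn).symm

theorem norm_sub_le_of_le (h : IsAsymptoticSubgradientSequence f α x y R C) {m n : ℕ}
    (hmn : m ≤ n) : ‖x n - x m‖ ≤ C * (elapsedTime α n - elapsedTime α m) := by
  rw [h.sub_eq_sum hmn, elapsedTime_sub_eq_sum hmn, Finset.mul_sum]
  refine norm_sum_le_of_le _ fun i _ => ?_
  rw [norm_smul, Real.norm_of_nonneg (h.nonneg i), mul_comm]
  exact mul_le_mul_of_nonneg_right (h.norm_direction_le i) (h.nonneg i)

theorem norm_sub_le (h : IsAsymptoticSubgradientSequence f α x y R C) (m n : ℕ) :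
    ‖x n - x m‖ ≤ C * |elapsedTime α n - elapsedTime α m| := by
  rcases le_total m n with hmn | hmn
  · exact (h.norm_sub_le_of_le hmn).trans
      (mul_le_mul_of_nonneg_left (le_abs_self _) h.bound_nonneg)
  · rw [norm_sub_rev, abs_sub_comm]
    exact (h.norm_sub_le_of_le hmn).trans
      (mul_le_mul_of_nonneg_left (le_abs_self _) h.bound_nonneg)

/-- The average direction over a range of steps lies in every convex set containing the
directions. -/
theorem average_mem (h : IsAsymptoticSubgradientSequence f α x y R C) {K : Set E}
    (hK : Convex ℝ K) {m n : ℕ} (hmn : m ≤ n) (hpos : 0 < elapsedTime α n - elapsedTime α m)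
    (hy : ∀ i ∈ Finset.Ico m n, y i ∈ K) :
    (elapsedTime α n - elapsedTime α m)⁻¹ • (x n - x m) ∈ K := by
  rw [h.sub_eq_sum hmn, elapsedTime_sub_eq_sum hmn] at *
  exact hK.centerMass_mem (fun i _ => h.nonneg i) hpos hy

/-- Near a given point, late directions are close to the negative subdifferential at that point. -/
theorem exists_eventually_mem_cthickening [FiniteDimensional ℝ E]
    (h : IsAsymptoticSubgradientSequence f α x y R C)
    (z : E) {ε : ℝ} (hε : 0 < ε) : ∃ δ > 0, ∀ᶠ n in atTop, dist (x n) z < δ →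
      y n ∈ Metric.cthickening ε (-clarkeSubdifferential f z) := by
  have key : ∀ᶠ n in atTop ⊓ comap x (𝓝 z),
      y n ∈ Metric.cthickening ε (-clarkeSubdifferential f z) := by
    by_contra hno
    have hfr := not_eventually.1 hno
    rw [frequently_iff_neBot] at hfr
    let l := Ultrafilter.of (atTop ⊓ comap x (𝓝 z) ⊓
      𝓟 {n | y n ∉ Metric.cthickening ε (-clarkeSubdifferential f z)})
    have hl : (l : Filter ℕ) ≤ _ := Ultrafilter.of_le _
    have hl1 : (l : Filter ℕ) ≤ atTop := hl.trans (inf_le_left.trans inf_le_left)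
    have hl2 : Tendsto x l (𝓝 z) :=
      tendsto_iff_comap.2 (hl.trans (inf_le_left.trans inf_le_right))
    have hl3 : ∀ᶠ n in (l : Filter ℕ), y n ∉ Metric.cthickening ε (-clarkeSubdifferential f z) :=
      hl.trans inf_le_right (mem_principal_self _)
    obtain ⟨v, -, hv⟩ := (isCompact_closedBall (0 : E) C).ultrafilter_le_nhds (l.map y)
      (tendsto_principal.2 (Eventually.of_forall fun n => by simpa using h.norm_direction_le n))
    have hmem : v ∈ -clarkeSubdifferential f z := h.neg_mem l z v hl1 hl2 hv
    have hnhds : Metric.cthickening ε (-clarkeSubdifferential f z) ∈ 𝓝 v :=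
      mem_of_superset (Metric.isOpen_thickening.mem_nhds (Metric.self_subset_thickening hε _ hmem))
        (Metric.thickening_subset_cthickening _ _)
    obtain ⟨n, hn, hn'⟩ := (hl3.and (hv hnhds)).exists
    exact hn hn'
  obtain ⟨s, hs, t, ht, hst⟩ := mem_inf_iff_superset.1 key
  obtain ⟨O, hO, hOt⟩ := mem_comap.1 ht
  obtain ⟨δ, hδ, hball⟩ := Metric.mem_nhds_iff.1 hO
  exact ⟨δ, hδ, mem_of_superset hs fun n hn hd => hst ⟨hn, hOt (hball hd)⟩⟩

/-- The limit along an ultrafilter of the shifted trajectories. -/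
theorem exists_limitArc [FiniteDimensional ℝ E]
    (h : IsAsymptoticSubgradientSequence f α x y R C) (l : Ultrafilter ℕ) :
    ∃ z : ℝ → E, ∀ t, Tendsto (fun k => x (stepIndex α k t)) l (𝓝 (z t)) := by
  -- The same ultrafilter converges in the compact ball for every `t`, so neither Arzelà–Ascoli nor
  -- a diagonal extraction is needed.
  have : ∀ t : ℝ, ∃ z : E, Tendsto (fun k => x (stepIndex α k t)) l (𝓝 z) := fun t => by
    obtain ⟨v, -, hv⟩ := (isCompact_closedBall (0 : E) R).ultrafilter_le_nhds
      (l.map fun k => x (stepIndex α k t)) (tendsto_principal.2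
        (Eventually.of_forall fun n => by simpa using h.norm_le _))
    exact ⟨v, hv⟩
  exact ⟨fun t => (this t).choose, fun t => (this t).choose_spec⟩

variable {l : Ultrafilter ℕ} {z : ℝ → E}

/-- Since displacement is at most `C` times elapsed time, only the limit of the elapsed times
matters. This admits stopping indices such as the ends of crossings. -/
theorem tendsto_limitArc (h : IsAsymptoticSubgradientSequence f α x y R C)
    (hl : (l : Filter ℕ) ≤ atTop)
    (hz : ∀ t, Tendsto (fun k => x (stepIndex α k t)) l (𝓝 (z t))) {e : ℕ → ℕ} {s : ℝ}
    (hs : 0 ≤ s) (he : Tendsto (fun k => elapsedTime α (e k) - elapsedTime α k) l (𝓝 s)) :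
    Tendsto (fun k => x (e k)) l (𝓝 (z s)) := by
  have h1 := (tendsto_elapsedTime_stepIndex h.nonneg h.tendsto_zero h.tendsto_time s).mono_left hl
  rw [max_eq_left hs] at h1
  have h2 : Tendsto (fun k => C * |elapsedTime α (e k) - elapsedTime α (stepIndex α k s)|)
      l (𝓝 0) := by
    have := ((he.sub h1).abs).const_mul C
    simpa using this
  have h3 : Tendsto (fun k => x (e k) - x (stepIndex α k s)) l (𝓝 0) :=
    squeeze_zero_norm (fun k => h.norm_sub_le _ _) h2
  simpa using h3.add (hz s)

theorem lipschitzWith_limitArc (h : IsAsymptoticSubgradientSequence f α x y R C)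
    (hl : (l : Filter ℕ) ≤ atTop)
    (hz : ∀ t, Tendsto (fun k => x (stepIndex α k t)) l (𝓝 (z t))) :
    LipschitzWith C.toNNReal z := by
  refine LipschitzWith.of_dist_le_mul fun s t => ?_
  rw [Real.coe_toNNReal _ h.bound_nonneg, dist_eq_norm, Real.dist_eq]
  have hT := fun t => (tendsto_elapsedTime_stepIndex h.nonneg h.tendsto_zero h.tendsto_time
    t).mono_left hl
  have h1 := (((hT s).sub (hT t)).abs).const_mul C
  have h2 := le_of_tendsto_of_tendsto ((hz s).sub (hz t)).norm h1 (Eventually.of_forall fun k => by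
    simpa using h.norm_sub_le (stepIndex α k t) (stepIndex α k s))
  exact h2.trans (mul_le_mul_of_nonneg_left (abs_max_sub_max_le_abs s t 0) h.bound_nonneg)

/-- Limit arcs solve the subgradient differential inclusion. -/
theorem neg_mem_of_hasDerivAt_limitArc [FiniteDimensional ℝ E] (hf : LocallyLipschitz f)
    (h : IsAsymptoticSubgradientSequence f α x y R C) (hl : (l : Filter ℕ) ≤ atTop)
    (hz : ∀ t, Tendsto (fun k => x (stepIndex α k t)) l (𝓝 (z t))) {t : ℝ} (ht : 0 ≤ t) {w : E}
    (hw : HasDerivAt z w t) : -w ∈ clarkeSubdifferential f (z t) := by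
  have hT := fun t => (tendsto_elapsedTime_stepIndex h.nonneg h.tendsto_zero h.tendsto_time
    t).mono_left hl
  suffices hmem : w ∈ closure (-clarkeSubdifferential f (z t)) by
    rw [(hf.isCompact_clarkeSubdifferential (z t)).isClosed.neg.closure_eq] at hmem
    exact hmem
  rw [Metric.closure_eq_iInter_cthickening]
  refine mem_iInter₂.2 fun ε hε => ?_
  obtain ⟨δ, hδ, hev⟩ := h.exists_eventually_mem_cthickening (z t) hε
  set K := Metric.cthickening ε (-clarkeSubdifferential f (z t)) with hKdef
  have hKc : Convex ℝ K := (convex_clarkeSubdifferential f (z t)).neg.cthickening ε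
  have hslope : Tendsto (fun s => s⁻¹ • (z (t + s) - z t)) (𝓝[>] 0) (𝓝 w) :=
    hw.tendsto_slope_zero_right
  refine Metric.isClosed_cthickening.mem_of_tendsto hslope ?_
  -- During a window of duration `s` the iterates move by less than δ/2, so they stay within δ of `z
  -- t` and their directions lie in the convex set `K`. The difference quotient is a limit of
  -- averages of these directions.
  have hsmall : ∀ᶠ s in 𝓝[>] (0 : ℝ), C * s < δ / 2 := by
    have : Tendsto (fun s : ℝ => C * s) (𝓝[>] 0) (𝓝 0) := by
      have := (continuous_const_mul C).tendsto (0 : ℝ)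
      rw [mul_zero] at this
      exact this.mono_left nhdsWithin_le_nhds
    exact this.eventually_lt_const (by positivity)
  filter_upwards [hsmall, self_mem_nhdsWithin] with s hs hs0
  have hs0 : 0 < s := hs0
  have hdiff : Tendsto (fun k => elapsedTime α (stepIndex α k (t + s)) -
      elapsedTime α (stepIndex α k t)) l (𝓝 s) := by
    have := (hT (t + s)).sub (hT t)
    rw [max_eq_left (by linarith), max_eq_left ht] at this
    simpa using this
  refine Metric.isClosed_cthickening.mem_of_tendsto
    ((hdiff.inv₀ hs0.ne').smul ((hz (t + s)).sub (hz t))) ?_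
  have e1 : ∀ᶠ k in (l : Filter ℕ), dist (x (stepIndex α k t)) (z t) < δ / 2 :=
    Metric.tendsto_nhds.1 (hz t) _ (by positivity)
  have e2 := (hdiff.const_mul C).eventually_lt_const hs
  have e3 := hdiff.eventually_const_lt hs0
  have e4 : ∀ᶠ k in (l : Filter ℕ), ∀ n ≥ k, dist (x n) (z t) < δ → y n ∈ K :=
    hl (eventually_forall_ge_atTop.2 hev)
  filter_upwards [e1, e2, e3, e4] with k h1 h2 h3 h4
  refine h.average_mem hKc (stepIndex_mono h.tendsto_time k (by linarith)) h3 fun n hn => ?_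
  rw [Finset.mem_Ico] at hn
  refine h4 n ((stepIndex_mem h.tendsto_time k t).1.trans hn.1) ?_
  have h5 := h.norm_sub_le_of_le hn.1
  have h6 := monotone_elapsedTime h.nonneg hn.2.le
  have h7 := mul_le_mul_of_nonneg_left (sub_le_sub_right h6
    (elapsedTime α (stepIndex α k t))) h.bound_nonneg
  have h8 := dist_triangle (x n) (x (stepIndex α k t)) (z t)
  rw [dist_eq_norm (x n) (x (stepIndex α k t))] at h8
  linarith

end IsAsymptoticSubgradientSequence

/-- A Lipschitz solution of the subgradient differential inclusion that starts at a noncritical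
point decreases the function. -/
theorem IsWhitneyStratification.exists_le_sub_mul [FiniteDimensional ℝ E] {f : E → ℝ} {p : ℕ}
    {A : Set (Set (WithLp 2 (E × ℝ)))} (hp : p ≠ 0) (hf : LocallyLipschitz f)
    (hA : IsWhitneyStratification p (euclideanGraph f) A) {K : NNReal} {z : ℝ → E}
    (hz : LipschitzWith K z)
    (hincl : ∀ t, 0 ≤ t → ∀ w, HasDerivAt z w t → -w ∈ clarkeSubdifferential f (z t))
    (hcrit : ¬ IsClarkeCritical f (z 0)) :
    ∃ τ > 0, ∃ c > 0, ∀ t ∈ Icc 0 τ, f (z t) ≤ f (z 0) - c * t := by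
  obtain ⟨c, hc, hcnear⟩ := hf.exists_eventually_le_norm hcrit
  obtain ⟨K', O, hO, hK'⟩ := hf (z 0)
  have hev : ∀ᶠ t in 𝓝 (0 : ℝ), z t ∈ O ∧ ∀ v ∈ clarkeSubdifferential f (z t), c ≤ ‖v‖ :=
    hz.continuous.continuousAt.eventually (Filter.inter_mem hO hcnear)
  obtain ⟨τ, hτ, hball⟩ := Metric.eventually_nhds_iff_ball.1 hev
  refine ⟨τ / 2, by positivity, c ^ 2, by positivity, fun t ht => ?_⟩
  have hin : ∀ s ∈ Icc 0 t, s ∈ Metric.ball (0 : ℝ) τ := fun s hs => by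
    rw [Metric.mem_ball, Real.dist_eq, sub_zero, abs_of_nonneg hs.1]
    linarith [hs.2, ht.2]
  have hlip : LipschitzOnWith (K' * K) (fun s => f (z s)) (uIcc 0 t) := by
    rw [uIcc_of_le ht.1]
    exact hK'.comp hz.lipschitzOnWith fun s hs => (hball s (hin s hs)).1
  have hac := hlip.absolutelyContinuousOnInterval
  have hFTC := hac.integral_deriv_eq_sub
  have hmono : ∫ s in (0 : ℝ)..t, deriv (fun s => f (z s)) s ≤ ∫ _ in (0 : ℝ)..t, -c ^ 2 := by
    refine intervalIntegral.integral_mono_ae_restrict ht.1 hac.intervalIntegrable_deriv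
      intervalIntegrable_const ?_
    rw [EventuallyLE, ae_restrict_iff' measurableSet_Icc]
    filter_upwards [hac.ae_differentiableAt, hz.ae_differentiableAt_real,
      hA.ae_deriv_comp_eq hp hf.continuous z] with s h1 h2 h3 hs
    -- The chain rule holds for every subgradient; choosing -z'(s) gives the derivative -‖z'(s)‖² ≤
    -- -c².
    have hmem := hincl s hs.1 _ h2.hasDerivAt
    rw [h3 h2 (h1 (by rwa [uIcc_of_le ht.1])) _ hmem, inner_neg_left, real_inner_self_eq_norm_sq]
    have h4 := (hball s (hin s hs)).2 _ hmem
    rw [norm_neg] at h4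
    have := pow_le_pow_left₀ hc.le h4 2
    linarith
  rw [hFTC, intervalIntegral.integral_const, smul_eq_mul] at hmono
  linarith

end LimitArcs

/-! ### Convergence of subgradient sequences -/

section Convergence

variable {E : Type*} [NormedAddCommGroup E] [InnerProductSpace ℝ E] [FiniteDimensional ℝ E]
  [CompleteSpace E] {f : E → ℝ} {p : ℕ} {A : Set (Set (WithLp 2 (E × ℝ)))} {α : ℕ → ℝ}
  {x y ξ : ℕ → E} {R C : ℝ}

/-- A sequence of reals which is infinitely often below `a` and infinitely often above `b` crosses
upwards from `a` to `b` infinitely often. -/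
theorem frequently_upcrossing {u : ℕ → ℝ} {a b : ℝ} (hab : a < b) (ha : ∃ᶠ n in atTop, u n < a)
    (hb : ∃ᶠ n in atTop, b < u n) :
    ∃ᶠ i in atTop, u i ≤ a ∧ ∃ e, i < e ∧ b ≤ u e ∧ ∀ j, i < j → j ≤ e → a < u j := by
  rw [frequently_atTop] at *
  intro N
  obtain ⟨n, hNn, hn⟩ := ha N
  obtain ⟨e, hne, he⟩ := hb n
  classical
  -- The crossing starts at the last index up to `e` with value at most `a`.
  have hspec : u (Nat.findGreatest (fun j => u j ≤ a) e) ≤ a :=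
    Nat.findGreatest_spec (P := fun j => u j ≤ a) hne hn.le
  have hle : n ≤ Nat.findGreatest (fun j => u j ≤ a) e := Nat.le_findGreatest hne hn.le
  refine ⟨_, hNn.trans hle, hspec, e, ?_, he.le, fun j hj hje => ?_⟩
  · refine lt_of_le_of_ne (Nat.findGreatest_le e) fun heq => ?_
    rw [heq] at hspec
    linarith
  · exact not_le.1 (Nat.findGreatest_is_greatest hj hje)

namespace IsAsymptoticSubgradientSequence

theorem exists_le_sub_mul_of_limitArc (hp : p ≠ 0) (hf : LocallyLipschitz f)
    (hA : IsWhitneyStratification p (euclideanGraph f) A)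
    (h : IsAsymptoticSubgradientSequence f α x y R C) {l : Ultrafilter ℕ}
    (hl : (l : Filter ℕ) ≤ atTop) {z : ℝ → E}
    (hz : ∀ t, Tendsto (fun k => x (stepIndex α k t)) l (𝓝 (z t)))
    (hcrit : ¬ IsClarkeCritical f (z 0)) :
    ∃ τ > 0, ∃ c > 0, ∀ t ∈ Icc 0 τ, f (z t) ≤ f (z 0) - c * t :=
  hA.exists_le_sub_mul hp hf (h.lipschitzWith_limitArc hl hz)
    (fun _ ht _ hw => h.neg_mem_of_hasDerivAt_limitArc hf hl hz ht hw) hcrit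

/-- The function values cannot cross infinitely often upwards from a noncritical value. -/
theorem not_frequently_upcrossing (hp : p ≠ 0) (hf : LocallyLipschitz f)
    (hA : IsWhitneyStratification p (euclideanGraph f) A)
    (h : IsAsymptoticSubgradientSequence f α x y R C) {a b : ℝ} (hab : a < b)
    (ha : ∀ z, IsClarkeCritical f z → f z ≠ a) :
    ¬ ((∃ᶠ n in atTop, f (x n) < a) ∧ ∃ᶠ n in atTop, b < f (x n)) := by
  rintro ⟨hlow, hhigh⟩
  have hcross := frequently_upcrossing hab hlow hhigh
  rw [frequently_iff_neBot] at hcross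
  let l := Ultrafilter.of (atTop ⊓ 𝓟 {i | f (x i) ≤ a ∧ ∃ e, i < e ∧ b ≤ f (x e) ∧
    ∀ j, i < j → j ≤ e → a < f (x j)})
  have hl : (l : Filter ℕ) ≤ _ := Ultrafilter.of_le _
  have hl1 : (l : Filter ℕ) ≤ atTop := hl.trans inf_le_left
  have hl2 : ∀ᶠ i in (l : Filter ℕ), f (x i) ≤ a ∧ ∃ e, i < e ∧ b ≤ f (x e) ∧
    ∀ j, i < j → j ≤ e → a < f (x j) := hl.trans inf_le_right (mem_principal_self _)
  obtain ⟨e, he⟩ : ∃ e : ℕ → ℕ, ∀ᶠ i in (l : Filter ℕ), f (x i) ≤ a ∧ i < e i ∧ b ≤ f (x (e i)) ∧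
      ∀ j, i < j → j ≤ e i → a < f (x j) := by
    refine ⟨fun i => Classical.epsilon fun e => i < e ∧ b ≤ f (x e) ∧
      ∀ j, i < j → j ≤ e → a < f (x j), hl2.mono fun i hi => ⟨hi.1, ?_⟩⟩
    exact Classical.epsilon_spec hi.2
  obtain ⟨z, hz⟩ := h.exists_limitArc l
  have hz0 : Tendsto x l (𝓝 (z 0)) := by
    simpa only [stepIndex_zero h.tendsto_time] using hz 0
  -- One step takes vanishing time, so `x k` and `x (k + 1)` have the same limit; their values lie
  -- on opposite sides of `a`, which forces f(z 0) = a.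
  have hz1 : Tendsto (fun k => x (k + 1)) l (𝓝 (z 0)) := by
    refine h.tendsto_limitArc hl1 hz le_rfl ?_
    simpa [elapsedTime_succ] using h.tendsto_zero.mono_left hl1
  have hfc := hf.continuous
  have hle : f (z 0) ≤ a :=
    le_of_tendsto ((hfc.tendsto _).comp hz0) (he.mono fun i hi => hi.1)
  have hge : a ≤ f (z 0) :=
    ge_of_tendsto ((hfc.tendsto _).comp hz1)
      (he.mono fun i hi => (hi.2.2.2 (i + 1) (Nat.lt_succ_self i) hi.2.1).le)
  have hfz : f (z 0) = a := le_antisymm hle hge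
  obtain ⟨τ, hτ, c, hc, hdesc⟩ := h.exists_le_sub_mul_of_limitArc hp hf hA hl1 hz
    fun hcr => ha _ hcr hfz
  have hlt : f (z τ) < a := by
    have := hdesc τ ⟨hτ.le, le_rfl⟩
    have : 0 < c * τ := mul_pos hc hτ
    linarith
  have hev : ∀ᶠ k in (l : Filter ℕ), f (x (stepIndex α k τ)) < a :=
    ((hfc.tendsto _).comp (hz τ)).eventually_lt_const hlt
  -- A crossing lasting longer than `τ` would contain the index `stepIndex α k τ`, where the value
  -- is below `a`. So the crossing durations converge to some s ∈ [0, τ], and f(z s) ≥ b contradicts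
  -- the descent.
  have htime : ∀ᶠ k in (l : Filter ℕ),
      elapsedTime α (e k) - elapsedTime α k ∈ Icc 0 τ := by
    filter_upwards [he, hev] with k hk hk'
    refine ⟨sub_nonneg.2 (monotone_elapsedTime h.nonneg hk.2.1.le), ?_⟩
    by_contra! hgt
    have h1 : stepIndex α k τ ≤ e k := stepIndex_le hk.2.1.le (by linarith)
    obtain ⟨h2, h3⟩ := stepIndex_mem h.tendsto_time k τ
    have h4 : k < stepIndex α k τ := by
      refine lt_of_le_of_ne h2 fun heq => ?_
      rw [← heq] at h3
      linarith
    exact absurd (hk.2.2.2 _ h4 h1) (not_lt.2 hk'.le)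
  obtain ⟨s, hs, hs'⟩ := isCompact_Icc.ultrafilter_le_nhds
    (l.map fun k => elapsedTime α (e k) - elapsedTime α k) (tendsto_principal.2 htime)
  have hlim := h.tendsto_limitArc hl1 hz hs.1 (e := e) hs'
  have hb : b ≤ f (z s) :=
    ge_of_tendsto ((hfc.tendsto _).comp hlim) (he.mono fun i hi => hi.2.2.1)
  have h5 := hdesc s hs
  have h6 : 0 ≤ c * s := mul_nonneg hc.le hs.1
  linarith

/-- Noncritical values are dense because critical values are null, and a bounded sequence without
upcrossings between levels of a dense set converges. -/
theorem exists_tendsto_apply (hp : p ≠ 0) (hpE : Module.finrank ℝ E ≤ p)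
    (hf : LocallyLipschitz f) (hA : IsWhitneyStratification p (euclideanGraph f) A)
    (h : IsAsymptoticSubgradientSequence f α x y R C) :
    ∃ L : ℝ, Tendsto (fun n => f (x n)) atTop (𝓝 L) := by
  have hnull := hA.volume_image_critical_eq_zero hp hpE hf.continuous
  have hdense : Dense {a : ℝ | ∀ z, IsClarkeCritical f z → f z ≠ a} := by
    refine Measure.dense_of_ae (μ := volume) ?_
    filter_upwards [measure_eq_zero_iff_ae_notMem.1 hnull] with a ha z hz hza
    exact ha ⟨z, hz, hza⟩
  have hbdd : IsCompact (f '' Metric.closedBall 0 R) :=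
    (isCompact_closedBall (0 : E) R).image hf.continuous
  have hmem : ∀ n, f (x n) ∈ f '' Metric.closedBall 0 R := fun n =>
    mem_image_of_mem f (by simpa using h.norm_le n)
  refine tendsto_of_no_upcrossings hdense
    (fun a ha b _ hab => h.not_frequently_upcrossing hp hf hA hab ha) ?_ ?_
  · obtain ⟨B, hB⟩ := hbdd.bddAbove
    exact isBoundedUnder_of ⟨B, fun n => hB (hmem n)⟩
  · obtain ⟨B, hB⟩ := hbdd.bddBelow
    exact isBoundedUnder_of ⟨B, fun n => hB (hmem n)⟩

/-- Convergence of the values makes `f` constant along the limit arc starting at `z₀`, whereas a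
noncritical start would force a strict decrease. -/
theorem isClarkeCritical_of_tendsto (hp : p ≠ 0) (hpE : Module.finrank ℝ E ≤ p)
    (hf : LocallyLipschitz f) (hA : IsWhitneyStratification p (euclideanGraph f) A)
    (h : IsAsymptoticSubgradientSequence f α x y R C) {l : Ultrafilter ℕ}
    (hl : (l : Filter ℕ) ≤ atTop) {z₀ : E} (hz₀ : Tendsto x l (𝓝 z₀)) :
    IsClarkeCritical f z₀ := by
  obtain ⟨L, hL⟩ := h.exists_tendsto_apply hp hpE hf hA
  obtain ⟨z, hz⟩ := h.exists_limitArc l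
  have hvalue : ∀ t, f (z t) = L := fun t => by
    refine tendsto_nhds_unique ((hf.continuous.tendsto _).comp (hz t)) ?_
    have hidx : Tendsto (fun k => stepIndex α k t) l atTop :=
      (tendsto_atTop_mono (fun k => (stepIndex_mem h.tendsto_time k t).1) tendsto_id).mono_left hl
    exact hL.comp hidx
  have h0 : z 0 = z₀ := tendsto_nhds_unique (hz 0)
    (by simpa only [stepIndex_zero h.tendsto_time] using hz₀)
  by_contra hcrit
  obtain ⟨τ, hτ, c, hc, hdesc⟩ := h.exists_le_sub_mul_of_limitArc hp hf hA hl hz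
    (by rwa [h0])
  have h1 := hdesc τ ⟨hτ.le, le_rfl⟩
  rw [hvalue, hvalue] at h1
  have := mul_pos hc hτ
  linarith

end IsAsymptoticSubgradientSequence

theorem StepSizes.tendsto_zero (hα : StepSizes α) : Tendsto α atTop (𝓝 0) := by
  have h := hα.sq_summable.tendsto_atTop_zero.sqrt
  rw [Real.sqrt_zero] at h
  exact h.congr fun n => Real.sqrt_sq (hα.nonneg n)

theorem StepSizes.tendsto_elapsedTime (hα : StepSizes α) :
    Tendsto (elapsedTime α) atTop atTop :=
  (not_summable_iff_tendsto_nat_atTop_of_nonneg hα.nonneg).1 hα.not_summable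

/-- Convergence of subgradient steps perturbed by a convergent noise series. -/
theorem IsWhitneyStratification.critical_and_tendsto_of_noise (hp : p ≠ 0)
    (hpE : Module.finrank ℝ E ≤ p) (hf : LocallyLipschitz f)
    (hA : IsWhitneyStratification p (euclideanGraph f) A) (hα : StepSizes α)
    (hstep : ∀ k, x (k + 1) = x k + α k • (y k + ξ k)) (hx : ∃ C : ℝ, ∀ k, ‖x k‖ ≤ C)
    (hy : ∃ C : ℝ, ∀ k, ‖y k‖ ≤ C)
    (hξ : ∃ v : E, Tendsto (fun n => ∑ k ∈ Finset.range n, α k • ξ k) atTop (𝓝 v))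
    (hneg : ∀ (l : Ultrafilter ℕ) (z v : E), (l : Filter ℕ) ≤ atTop → Tendsto x l (𝓝 z) →
      Tendsto y l (𝓝 v) → -v ∈ clarkeSubdifferential f z) :
    (∀ z, MapClusterPt z atTop x → IsClarkeCritical f z) ∧
      ∃ L : ℝ, Tendsto (fun k => f (x k)) atTop (𝓝 L) := by
  obtain ⟨Cx, hCx⟩ := hx
  obtain ⟨Cy, hCy⟩ := hy
  obtain ⟨v, hv⟩ := hξ
  -- The tail of the noise series: `x + S` obeys the recursion without noise, and `S` tends to 0, so
  -- limit points are unchanged.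
  set S : ℕ → E := fun n => v - ∑ k ∈ Finset.range n, α k • ξ k with hS
  have hS0 : Tendsto S atTop (𝓝 0) := by simpa using hv.const_sub v
  obtain ⟨B, hB⟩ := (Metric.isBounded_range_of_tendsto S hS0).exists_norm_le
  have hSl : ∀ {l : Ultrafilter ℕ} {z : E}, (l : Filter ℕ) ≤ atTop →
      (Tendsto (fun n => x n + S n) l (𝓝 z) ↔ Tendsto x l (𝓝 z)) := by
    intro l z hl
    constructor
    · intro h
      simpa using h.sub (hS0.mono_left hl)
    · intro h
      simpa using h.add (hS0.mono_left hl)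
  have hseq : IsAsymptoticSubgradientSequence f α (fun n => x n + S n) y (Cx + B) Cy := by
    refine ⟨fun n => ?_, hα.nonneg, hα.tendsto_zero, hα.tendsto_elapsedTime, fun n => ?_, hCy,
      fun l z w hl hz hw => hneg l z w hl ((hSl hl).1 hz) hw⟩
    · simp only [hS, hstep, Finset.sum_range_succ, smul_add]
      abel
    · exact (norm_add_le _ _).trans (add_le_add (hCx n) (hB _ (mem_range_self n)))
  refine ⟨fun z hz => ?_, ?_⟩
  · obtain ⟨l, hl, hlz⟩ := mapClusterPt_iff_ultrafilter.1 hz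
    exact hseq.isClarkeCritical_of_tendsto hp hpE hf hA hl ((hSl hl).2 hlz)
  · obtain ⟨L, hL⟩ := hseq.exists_tendsto_apply hp hpE hf hA
    refine ⟨L, (tendsto_iff_ultrafilter _ _ _).2 fun l hl => ?_⟩
    obtain ⟨z, -, hz⟩ := (isCompact_closedBall (0 : E) Cx).ultrafilter_le_nhds (l.map x)
      (tendsto_principal.2 (Eventually.of_forall fun n => by simpa using hCx n))
    have hz : Tendsto x l (𝓝 z) := hz
    have h1 : Tendsto (fun n => f (x n + S n)) l (𝓝 (f z)) :=
      (hf.continuous.tendsto z).comp ((hSl hl).2 hz)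
    rw [tendsto_nhds_unique (hL.mono_left hl) h1]
    exact (hf.continuous.tendsto z).comp hz

/-- The averaging condition forces limits of directions to be negative subgradients. -/
theorem StochasticApproximation.neg_mem_clarkeSubdifferential (hf : LocallyLipschitz f)
    (h : StochasticApproximation univ (fun z => -clarkeSubdifferential f z) α x y ξ)
    {l : Ultrafilter ℕ} {z v : E} (hl : (l : Filter ℕ) ≤ atTop) (hz : Tendsto x l (𝓝 z))
    (hv : Tendsto y l (𝓝 v)) : -v ∈ clarkeSubdifferential f z := by
  -- Along a subsequence on which `x` and `y` both converge, the Cesàro means of `y` tend to `v`, so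
  -- the averaging condition puts `v` at distance 0 from the closed set -∂f(z).
  have hcl : MapClusterPt (z, v) atTop fun n => (x n, y n) :=
    mapClusterPt_iff_ultrafilter.2 ⟨l, hl, hz.prodMk_nhds hv⟩
  obtain ⟨κ, hκ, hlim⟩ := hcl.tendsto_subseq
  rw [nhds_prod_eq, tendsto_prod_iff'] at hlim
  have h1 := h.average κ z hκ hlim.1
  have hlimy : Tendsto (fun j => y (κ j)) atTop (𝓝 v) := hlim.2
  have h2 := ((Metric.continuous_infDist_pt (-clarkeSubdifferential f z)).tendsto v).comp
    hlimy.cesaro_smul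
  have h3 := tendsto_nhds_unique h1 h2
  exact ((hf.isCompact_clarkeSubdifferential z).isClosed.neg.mem_iff_infDist_zero
    (hf.nonempty_clarkeSubdifferential z).neg).2 h3.symm

theorem LocallyLipschitz.isClarkeCritical_of_subsingleton [Subsingleton E]
    (hf : LocallyLipschitz f) (z : E) : IsClarkeCritical f z := by
  obtain ⟨v, hv⟩ := hf.nonempty_clarkeSubdifferential z
  rwa [Subsingleton.elim v 0] at hv

end Convergence

/-! ### Convergence of the noise series -/

section Noise

variable {Ω : Type*} {m0 : MeasurableSpace Ω} {μ : Measure Ω} [IsProbabilityMeasure μ]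
  {ℱ : Filtration ℕ m0}

/-- A square-integrable martingale difference series with summable variances converges almost
surely. -/
theorem ae_exists_tendsto_sum_of_condExp_eq_zero {D : ℕ → Ω → ℝ}
    (hmeas : ∀ k, StronglyMeasurable[ℱ (k + 1)] (D k)) (hL2 : ∀ k, MemLp (D k) 2 μ)
    (hcond : ∀ k, μ[D k | ℱ k] =ᵐ[μ] 0) (hsum : Summable fun k => ∫ ω, D k ω ^ 2 ∂μ) :
    ∀ᵐ ω ∂μ, ∃ c, Tendsto (fun n => ∑ k ∈ Finset.range n, D k ω) atTop (𝓝 c) := by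
  set M : ℕ → Ω → ℝ := fun n ω => ∑ k ∈ Finset.range n, D k ω with hM
  have hMmeas : StronglyAdapted ℱ M := fun n => by
    refine Finset.stronglyMeasurable_fun_sum _ fun k hk => ?_
    exact (hmeas k).mono (ℱ.mono (Finset.mem_range.1 hk))
  have hML2 : ∀ n, MemLp (M n) 2 μ := fun n => memLp_finsetSum _ fun k _ => hL2 k
  have hMint : ∀ n, Integrable (M n) μ := fun n => (hML2 n).integrable (by norm_num)
  have hDint : ∀ n, Integrable (D n) μ := fun n => (hL2 n).integrable (by norm_num)
  have hsucc : ∀ n, M (n + 1) = M n + D n := fun n => by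
    ext ω
    exact Finset.sum_range_succ _ _
  have hmart : Martingale M ℱ μ := by
    refine martingale_of_condExp_sub_eq_zero_nat hMmeas hMint fun n => ?_
    rw [hsucc, add_sub_cancel_left]
    exact hcond n
  have horth : ∀ n, ∫ ω, M n ω * D n ω ∂μ = 0 := fun n => by
    have hint : Integrable (M n * D n) μ := (hML2 n).integrable_mul (hL2 n)
    have h1 := condExp_mul_of_stronglyMeasurable_left (hMmeas n) hint (hDint n)
    have h2 : ∫ ω, (μ[M n * D n | ℱ n]) ω ∂μ = ∫ ω, (M n * D n) ω ∂μ := integral_condExp (ℱ.le n)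
    have h3 : ∫ ω, (μ[M n * D n | ℱ n]) ω ∂μ = 0 := by
      refine integral_eq_zero_of_ae ?_
      filter_upwards [h1, hcond n] with ω ha hb
      rw [ha, Pi.mul_apply, hb]
      simp
    rw [h3] at h2
    exact h2.symm
  have hsq : ∀ n, ∫ ω, M n ω ^ 2 ∂μ = ∑ k ∈ Finset.range n, ∫ ω, D k ω ^ 2 ∂μ := fun n => by
    induction n with
    | zero => simp [hM]
    | succ n ih =>
      rw [Finset.sum_range_succ, ← ih]
      have hexp : ∀ ω, M (n + 1) ω ^ 2 = M n ω ^ 2 + 2 * (M n ω * D n ω) + D n ω ^ 2 := fun ω => by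
        rw [hsucc, Pi.add_apply]; ring
      have i1 : Integrable (fun ω => M n ω ^ 2) μ := (hML2 n).integrable_sq
      have i2 : Integrable (fun ω => 2 * (M n ω * D n ω)) μ :=
        ((hML2 n).integrable_mul (hL2 n)).const_mul 2
      have i3 : Integrable (fun ω => D n ω ^ 2) μ := (hL2 n).integrable_sq
      have i12 : Integrable (fun ω => M n ω ^ 2 + 2 * (M n ω * D n ω)) μ := i1.add i2
      simp_rw [hexp]
      rw [integral_add i12 i3, integral_add i1 i2, integral_const_mul, horth]
      simp
  set V := ∑' k, ∫ ω, D k ω ^ 2 ∂μ with hV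
  have hbound : ∀ n, eLpNorm (M n) 1 μ ≤ ((1 + V).toNNReal : ℝ≥0∞) := fun n => by
    rw [eLpNorm_one_eq_lintegral_enorm, ← ofReal_integral_norm_eq_lintegral_enorm (hMint n)]
    refine ENNReal.ofReal_le_ofReal ?_
    -- Orthogonality of increments bounds the second moments, hence the L¹ norms, as the martingale
    -- convergence theorem requires.
    calc ∫ ω, ‖M n ω‖ ∂μ ≤ ∫ ω, (1 + M n ω ^ 2) ∂μ := by
          refine integral_mono (hMint n).norm ((integrable_const 1).add (hML2 n).integrable_sq)
            fun ω => ?_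
          change |M n ω| ≤ 1 + M n ω ^ 2
          rw [← sq_abs]
          nlinarith [sq_nonneg (|M n ω| - 1), abs_nonneg (M n ω)]
      _ = 1 + ∫ ω, M n ω ^ 2 ∂μ := by
          rw [integral_add (integrable_const 1) (hML2 n).integrable_sq]
          simp
      _ ≤ 1 + V := by
          rw [hsq]
          have := hsum.sum_le_tsum (Finset.range n) fun k _ => integral_nonneg fun ω => sq_nonneg _
          linarith
  exact hmart.submartingale.exists_ae_tendsto_of_bdd hbound

variable {E : Type*} [NormedAddCommGroup E] [InnerProductSpace ℝ E] [CompleteSpace E]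

/-- The part of a scalar component of the noise series on which the conditional variances are at
most `N` converges almost surely. -/
theorem ae_exists_tendsto_sum_indicator {ξ : ℕ → Ω → E} {α : ℕ → ℝ}
    (hmeas : ∀ k, StronglyMeasurable[ℱ (k + 1)] (ξ k)) (hint : ∀ k, Integrable (ξ k) μ)
    (hcond : ∀ k, μ[ξ k | ℱ k] =ᵐ[μ] 0) (hα : Summable fun k => α k ^ 2) (N : ℕ) {e : E}
    (he : ‖e‖ = 1) :
    ∀ᵐ ω ∂μ, ∃ c, Tendsto (fun n => ∑ k ∈ Finset.range n,
      α k * {ω | condLExp (ℱ k) μ (fun ω => ‖ξ k ω‖ₑ ^ 2) ω ≤ N}.indicator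
        (fun ω => inner ℝ e (ξ k ω)) ω) atTop (𝓝 c) := by
  -- This event belongs to `ℱ k`, so restricting to it preserves the zero conditional mean; the
  -- truncated second moment is at most `N`.
  set B : ℕ → Set Ω := fun k => {ω | condLExp (ℱ k) μ (fun ω => ‖ξ k ω‖ₑ ^ 2) ω ≤ N} with hB
  set g : ℕ → Ω → ℝ := fun k ω => inner ℝ e (ξ k ω) with hg
  have hBm : ∀ k, MeasurableSet[ℱ k] (B k) := fun k =>
    measurableSet_le (measurable_condLExp _ _ _) measurable_const
  have hgm : ∀ k, StronglyMeasurable[ℱ (k + 1)] (g k) := fun k =>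
    (innerSL ℝ e).continuous.comp_stronglyMeasurable (hmeas k)
  have hgint : ∀ k, Integrable (g k) μ := fun k => (innerSL ℝ e).integrable_comp (hint k)
  have hdm : ∀ k, StronglyMeasurable[ℱ (k + 1)] ((B k).indicator (g k)) := fun k =>
    (hgm k).indicator (ℱ.mono (Nat.le_succ k) _ (hBm k))
  have hgcond : ∀ k, μ[g k | ℱ k] =ᵐ[μ] 0 := fun k => by
    have h1 := (innerSL ℝ e).comp_condExp_comm (m := ℱ k) (hint k)
    filter_upwards [h1, hcond k] with ω ha hb
    have ha' : (μ[g k | ℱ k]) ω = innerSL ℝ e ((μ[ξ k | ℱ k]) ω) := ha.symm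
    rw [ha', hb]
    simp
  have hlint : ∀ k, ∫⁻ ω, ‖(B k).indicator (g k) ω‖ₑ ^ 2 ∂μ ≤ N := fun k => by
    calc ∫⁻ ω, ‖(B k).indicator (g k) ω‖ₑ ^ 2 ∂μ
        ≤ ∫⁻ ω, (B k).indicator (fun ω => ‖ξ k ω‖ₑ ^ 2) ω ∂μ := by
          refine lintegral_mono fun ω => ?_
          by_cases hω : ω ∈ B k
          · simp only [indicator_of_mem hω]
            gcongr
            have : ‖g k ω‖ ≤ ‖ξ k ω‖ := by
              simpa [he] using norm_inner_le_norm (𝕜 := ℝ) e (ξ k ω)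
            exact enorm_le_iff_norm_le.2 this
          · simp [indicator_of_notMem hω]
      _ = ∫⁻ ω in B k, ‖ξ k ω‖ₑ ^ 2 ∂μ := lintegral_indicator (ℱ.le k _ (hBm k)) _
      _ = ∫⁻ ω in B k, condLExp (ℱ k) μ (fun ω => ‖ξ k ω‖ₑ ^ 2) ω ∂μ :=
          (setLIntegral_condLExp (ℱ.le k) μ _ (hBm k)).symm
      _ ≤ ∫⁻ _ in B k, (N : ℝ≥0∞) ∂μ :=
          setLIntegral_mono' (ℱ.le k _ (hBm k)) fun ω hω => hω
      _ ≤ N := by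
          rw [setLIntegral_const]
          exact mul_le_of_le_one_right zero_le prob_le_one
  have hdL2 : ∀ k, MemLp ((B k).indicator (g k)) 2 μ := fun k => by
    refine ⟨((hdm k).mono (ℱ.le _)).aestronglyMeasurable, ?_⟩
    rw [eLpNorm_lt_top_iff_lintegral_rpow_enorm_lt_top (by norm_num) (by norm_num)]
    simpa using (hlint k).trans_lt (ENNReal.natCast_lt_top N)
  have hsq : ∀ k, ∫ ω, (B k).indicator (g k) ω ^ 2 ∂μ ≤ N := fun k => by
    rw [integral_eq_lintegral_of_nonneg_ae (Eventually.of_forall fun ω => sq_nonneg _)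
      (hdL2 k).integrable_sq.aestronglyMeasurable]
    refine ENNReal.toReal_le_of_le_ofReal (Nat.cast_nonneg N) ?_
    rw [ENNReal.ofReal_natCast]
    refine le_trans (le_of_eq (lintegral_congr fun ω => ?_)) (hlint k)
    rw [← enorm_pow, Real.enorm_of_nonneg (sq_nonneg _)]
  refine ae_exists_tendsto_sum_of_condExp_eq_zero (ℱ := ℱ)
    (D := fun k ω => α k * (B k).indicator (g k) ω) (fun k => (hdm k).const_mul (α k))
    (fun k => (hdL2 k).const_mul (α k)) (fun k => ?_) ?_
  · have h1 : μ[fun ω => α k * (B k).indicator (g k) ω | ℱ k] =ᵐ[μ]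
        α k • μ[(B k).indicator (g k) | ℱ k] := condExp_smul (α k) ((B k).indicator (g k)) (ℱ k)
    filter_upwards [h1, condExp_indicator (hgint k) (hBm k), hgcond k] with ω ha hb hc
    rw [ha, Pi.smul_apply, hb]
    by_cases hω : ω ∈ B k
    · rw [indicator_of_mem hω, hc]; simp
    · rw [indicator_of_notMem hω]; simp
  · refine Summable.of_nonneg_of_le (fun k => integral_nonneg fun ω => sq_nonneg _) (fun k => ?_)
      (hα.mul_right (N : ℝ))
    simp_rw [mul_pow]
    rw [integral_const_mul]
    exact mul_le_mul_of_nonneg_left (hsq k) (sq_nonneg _)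

variable [FiniteDimensional ℝ E]

/-- The noise series converges almost surely if the conditional variances are almost surely
bounded along the sequence. -/
theorem ae_exists_tendsto_sum_smul {ξ : ℕ → Ω → E} {α : ℕ → ℝ}
    (hmeas : ∀ k, StronglyMeasurable[ℱ (k + 1)] (ξ k)) (hint : ∀ k, Integrable (ξ k) μ)
    (hcond : ∀ k, μ[ξ k | ℱ k] =ᵐ[μ] 0) (hα : Summable fun k => α k ^ 2)
    (hbdd : ∀ᵐ ω ∂μ, ∃ N : ℕ, ∀ k, condLExp (ℱ k) μ (fun ω => ‖ξ k ω‖ₑ ^ 2) ω ≤ N) :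
    ∀ᵐ ω ∂μ, ∃ v, Tendsto (fun n => ∑ k ∈ Finset.range n, α k • ξ k ω) atTop (𝓝 v) := by
  let b := stdOrthonormalBasis ℝ E
  have hall := ae_all_iff.2 fun N : ℕ => ae_all_iff.2 fun i =>
    ae_exists_tendsto_sum_indicator hmeas hint hcond hα N (b.orthonormal.1 i)
  filter_upwards [hall, hbdd] with ω hω ⟨N, hN⟩
  have hcoord : ∀ i, ∃ c, Tendsto (fun n => inner ℝ (b i) (∑ k ∈ Finset.range n, α k • ξ k ω))
      atTop (𝓝 c) := fun i => by
    obtain ⟨c, hc⟩ := hω N i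
    refine ⟨c, hc.congr fun n => ?_⟩
    rw [inner_sum]
    refine Finset.sum_congr rfl fun k _ => ?_
    -- For the `N` belonging to this path the truncation never acts.
    have hk : ω ∈ {ω | condLExp (ℱ k) μ (fun ω => ‖ξ k ω‖ₑ ^ 2) ω ≤ N} := hN k
    rw [indicator_of_mem hk, inner_smul_right]
  choose c hc using hcoord
  refine ⟨∑ i, c i • b i, ?_⟩
  have := tendsto_finsetSum (f := fun i n => inner ℝ (b i) (∑ k ∈ Finset.range n, α k • ξ k ω) • b i)
    Finset.univ fun i _ => (hc i).smul_const (b i)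
  simpa only [b.sum_repr'] using this

/-- The iterates are bounded on almost every path, so `p` is bounded along it; the bound may depend
on the path, which the truncation allows for. -/
theorem StochasticSubgradientMethod.ae_exists_tendsto_noise [MeasurableSpace E] [BorelSpace E]
    {f : E → ℝ} {α : ℕ → ℝ} {x y ξ : ℕ → Ω → E} (h : StochasticSubgradientMethod μ f α x y ξ) :
    ∀ᵐ ω ∂μ, ∃ v, Tendsto (fun n => ∑ k ∈ Finset.range n, α k • ξ k ω) atTop (𝓝 v) := by
  obtain ⟨ℱ, hpast, p, -, hpB, hξ⟩ := h.noise
  refine ae_exists_tendsto_sum_smul (ℱ := ℱ) (fun k => ?_) (fun k => (hξ k).1)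
    (fun k => (hξ k).2.1) h.steps.sq_summable ?_
  · have h1 : Measurable[pastSigma x y ξ (k + 1)] (ξ k) := by
      refine measurable_iff_comap_le.2 (le_trans le_sup_right
        (le_iSup (fun j : {j : ℕ // j < k + 1} => MeasurableSpace.comap (x j) inferInstance ⊔
          MeasurableSpace.comap (y j) inferInstance ⊔ MeasurableSpace.comap (ξ j) inferInstance)
          ⟨k, Nat.lt_succ_self k⟩))
    exact (h1.mono (hpast _) le_rfl).stronglyMeasurable
  · filter_upwards [h.bounded_iterates, ae_all_iff.2 fun k => (hξ k).2.2] with ω ⟨C, hC⟩ hω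
    obtain ⟨P, hP⟩ := hpB (Metric.closedBall 0 C) Metric.isBounded_closedBall
    obtain ⟨N, hN⟩ := exists_nat_ge P
    refine ⟨N, fun k => (hω k).trans ?_⟩
    rw [← ENNReal.ofReal_natCast]
    exact ENNReal.ofReal_le_ofReal ((hP (mem_image_of_mem p (by simpa using hC k))).trans hN)

end Noise

/-! ### The two convergence statements -/

theorem mainTheorem1 {E : Type*} [NormedAddCommGroup E] [InnerProductSpace ℝ E]
    [FiniteDimensional ℝ E] [CompleteSpace E] [MeasurableSpace E] [BorelSpace E]
    (f : E → ℝ) (hf : LocallyLipschitz f)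
    (hstrat : IsWhitneyStratifiable (Module.finrank ℝ E) f) :
    (∀ (α : ℕ → ℝ) (x y ξ : ℕ → E),
      StochasticApproximation univ (fun z => -clarkeSubdifferential f z) α x y ξ →
        (∀ z, MapClusterPt z atTop x → IsClarkeCritical f z) ∧
        ∃ l : ℝ, Tendsto (fun k => f (x k)) atTop (𝓝 l)) ∧
    (∀ (Ω : Type*) [MeasurableSpace Ω] (μ : Measure Ω) [IsProbabilityMeasure μ]
      (α : ℕ → ℝ) (x y ξ : ℕ → Ω → E),
      StochasticSubgradientMethod μ f α x y ξ →
        ∀ᵐ ω ∂μ, (∀ z, MapClusterPt z atTop (fun k => x k ω) → IsClarkeCritical f z) ∧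
          ∃ l : ℝ, Tendsto (fun k => f (x k ω)) atTop (𝓝 l)) := by
  obtain ⟨A, hA⟩ := hstrat
  rcases eq_or_ne (Module.finrank ℝ E) 0 with h0 | hp
  -- For d = 0 the strata are only C^0, so the differential arguments do not apply; here the space
  -- is a single point.
  · have : Subsingleton E := Module.finrank_zero_iff.1 h0
    refine ⟨fun α x y ξ _ => ?_, fun Ω _ μ _ α x y ξ _ => Eventually.of_forall fun ω => ?_⟩ <;>
    exact ⟨fun z _ => hf.isClarkeCritical_of_subsingleton z, f 0, tendsto_const_nhds.congr
      fun k => congrArg f (Subsingleton.elim _ _)⟩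
  refine ⟨fun α x y ξ h => ?_, fun Ω _ μ _ α x y ξ h => ?_⟩
  · exact hA.critical_and_tendsto_of_noise hp le_rfl hf h.steps h.step h.bounded_iterates
      h.bounded_directions h.noise fun l z v hl hz hv =>
        h.neg_mem_clarkeSubdifferential hf hl hz hv
  · filter_upwards [h.step, h.subgradient, h.bounded_iterates, h.ae_exists_tendsto_noise]
      with ω hstep hsub ⟨C, hC⟩ ⟨v, hv⟩
    -- Pathwise, with signs reversed. The closed graph of ∂f replaces the averaging condition, and
    -- local boundedness of ∂f bounds the directions.
    refine hA.critical_and_tendsto_of_noise (y := fun k => -y k ω) (ξ := fun k => -ξ k ω) hp le_rfl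
      hf h.steps (fun k => ?_) ⟨C, hC⟩ ?_ ⟨-v, ?_⟩ fun l z w hl hz hw => ?_
    · rw [hstep k, ← neg_add, smul_neg, sub_eq_add_neg]
    · obtain ⟨B, hB⟩ := hf.exists_norm_clarkeSubdifferential_le (isCompact_closedBall (0 : E) C)
      exact ⟨B, fun k => by
        rw [norm_neg]
        exact hB _ (by simpa using hC k) _ (hsub k)⟩
    · simpa using hv.neg
    · exact hf.mem_clarkeSubdifferential_of_tendsto hz (by simpa using hw.neg)
        (Eventually.of_forall hsub)
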